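/- Let $|\cdot|$ be the Euclidean norm on $\mathbb{R}^d$ and the trace norm $|A|=(\mathrm{tr}\,A^TA)^{1/2}$ on $\mathbb{R}^{d\times m}$. Let $B$ be an $m$-dimensional Brownian motion on a probability space, and let $f:\mathbb{R}^d\to\mathbb{R}^d$ and $g:\mathbb{R}^d\to\mathbb{R}^{d\times m}$ be locally Lipschitz (Lipschitz on every ball) with $f(0)=0$, $g(0)=0$. For a function $U$ put $$\mathcal{L}U(x)=\langle D^{(1)}U(x),f(x)\rangle+\tfrac12\mathrm{tr}\big[g(x)^TD^{(2)}U(x)g(x)\big],$$ read as $0$ at $x=0$ (where $f$ and $g$ vanish) even if $U$ is not twice differentiable there. Let $\rho>0$, let $w:\mathbb{R}^d\to[0,\infty)$ be continuous, let $1/\delta\ge 4$ be an integer, and let $V:\mathbb{R}^d\to[0,\infty)$ be four times continuously differentiable with $V(x)\to\infty$ as $|x|\to\infty$, $V(x)=0$ iff $x=0$, and, for some $c>0$, $$|D^{(n)}V(x)|\le c\,V(x)^{1-n\delta}\qquad(n=1,2,3,4,\ x\in\mathbb{R}^d),$$ where $|D^{(n)}V(x)|$ is the Euclidean norm of the vector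 in $\mathbb{R}^{d^n}$ of all $n$-th order partial derivatives and $0^0=1$. Assume that $$\mathcal{L}V^\rho(x)\le -w(x)\quad\text{for all }x\in\mathbb{R}^d,\qquad V(\epsilon x)\le V(x)\quad\text{for all }x\in\mathbb{R}^d,\ 0<\epsilon\le1,$$ and, with $\Lambda_\rho(x)=\min\{1,\,w(x)/V^\rho(x)\}$ for $x\neq0$, that $$\sup_{0<|x|\le u}\frac{|f(x)|^2\vee|g(x)|^2}{\Lambda_\rho(x)V^{2\delta}(x)}<\infty\quad\text{for all }u>0 .$$ Let $\bar\varphi:(0,\infty)\to(0,\infty)$ be continuous and strictly increasing with $\bar\varphi(u)\to\infty$ as $u\to\infty$ and $$\sup_{0<|x|\le u}\Big[\frac{|f(x)|}{\Lambda_\rho^{1/2}(x)V^{\delta}(x)}\vee\frac{|g(x)|^2}{\Lambda_\rho(x)V^{2\delta}(x)}\Big]\le\bar\varphi(u)\quad\text{for all }u\ge1 .$$ (In these quotients a zero denominator requires a zero numerator, that is, $f(x)=0$ and $g(x)=0$ wherever $w(x)=0$; the quotient then counts as $0$.) Let $x_0\in\mathbb{R}^d$, $0<\bar\theta<1/2$,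 $K>0$ and $\Delta^*\in(0,1)$ satisfy $K(\Delta^*)^{-\bar\theta}\ge\bar\varphi(|x_0|\vee1)$. For $\Delta\in(0,\Delta^*]$ let $\bar\pi_\Delta(x)=\big(|x|\wedge\bar\varphi^{-1}(K\Delta^{-\bar\theta})\big)\frac{x}{|x|}$, with $\bar\pi_\Delta(0)=0$, and define the $V$-truncated Euler–Maruyama scheme by $Z_0=x_0$ and $$Z_{k+1}=\bar\pi_\Delta\Big(Z_k+f(Z_k)\Delta+g(Z_k)\big(B((k+1)\Delta)-B(k\Delta)\big)\Big),\qquad k\ge0 .$$ Then there is a constant $\Delta^{**}\in(0,\Delta^*]$ such that for every $\Delta\in(0,\Delta^{**}]$ $$\limsup_{k\to\infty}V^\rho(Z_k)<\infty\quad\text{and}\quad\lim_{k\to\infty}d(Z_k,\mathrm{Ker}\,w)=0\qquad\text{almost surely},$$ where $\mathrm{Ker}\,w=\{x: w(x)=0\}$. Moreover, if $w(x)=0$ iff $x=0$, then for every $\Delta\in(0,\Delta^{**}]$, $\lim_{k\to\infty}Z_k=0$ almost surely. -/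

import Mathlib

open MeasureTheory ProbabilityTheory Filter Topology
open scoped NNReal ENNReal

noncomputable section

namespace VTruncEM

/-- The state space `ℝ^d` with the Euclidean norm. -/
abbrev E (d : ℕ) : Type := EuclideanSpace ℝ (Fin d)

variable {d m : ℕ}

/-- The trace norm `|A| = (tr (Aᵀ A))^{1/2}` of a real matrix. -/
def traceNorm (A : Matrix (Fin d) (Fin m) ℝ) : ℝ :=
  Real.sqrt (Matrix.trace (A.transpose * A))

/-- The partial derivative `∂^n V / ∂x_{ι 0} ⋯ ∂x_{ι (n-1)}` at `x`. -/
def partialDeriv (n : ℕ) (V : E d → ℝ) (x : E d) (ι : Fin n → Fin d) : ℝ :=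
  iteratedFDeriv ℝ n V x (fun k => EuclideanSpace.single (ι k) (1 : ℝ))

/-- `|D^{(n)} V(x)|`: the Euclidean norm of the vector in `ℝ^{d^n}` of all `n`-th order partial
derivatives. -/
def normD (n : ℕ) (V : E d → ℝ) (x : E d) : ℝ :=
  Real.sqrt (∑ ι : Fin n → Fin d, (partialDeriv n V x ι) ^ 2)

/-- The Hessian matrix `D^{(2)} V(x)`. -/
def hessian (V : E d → ℝ) (x : E d) : Matrix (Fin d) (Fin d) ℝ :=
  Matrix.of fun i j => partialDeriv 2 V x ![i, j]

/-- `ℒ V(x) = ⟨D^{(1)} V(x), f(x)⟩ + ½ tr (g(x)ᵀ D^{(2)} V(x) g(x))`. -/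
def generator (f : E d → E d) (g : E d → Matrix (Fin d) (Fin m) ℝ) (V : E d → ℝ) (x : E d) : ℝ :=
  (∑ i, partialDeriv 1 V x ![i] * f x i)
    + 1 / 2 * Matrix.trace ((g x).transpose * hessian V x * g x)

/-- Local Lipschitz continuity of the drift and the diffusion coefficient. -/
def LocallyLipschitzCoeffs (f : E d → E d) (g : E d → Matrix (Fin d) (Fin m) ℝ) : Prop :=
  ∀ N : ℝ, 0 < N → ∃ C : ℝ, 0 < C ∧ ∀ x y : E d, max ‖x‖ ‖y‖ ≤ N →
    max ‖f x - f y‖ (traceNorm (g x - g y)) ≤ C * ‖x - y‖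

/-- The class of functions `V ∈ C^p(ℝ^d; [0,∞))` with `V(x) → ∞` as `|x| → ∞`, `Ker V = {0}` and
`|D^{(n)} V| ≤ c V^{1 - nδ}` for `n = 1, …, p` and some `c > 0` (with `0^0 = 1`). -/
structure LyapunovBar (p : ℕ) (δ : ℝ) (V : E d → ℝ) : Prop where
  contDiff : ContDiff ℝ p V
  nonneg : ∀ x, 0 ≤ V x
  tendsto : Tendsto V (Bornology.cobounded (E d)) atTop
  ker : {x | V x = 0} = {0}
  bound : ∃ c : ℝ, 0 < c ∧ ∀ n ∈ Finset.Icc 1 p, ∀ x, normD n V x ≤ c * V x ^ (1 - n * δ)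

/-- `Λ_ρ(x) = 1 ∧ (w(x) / V(x)^ρ)`; it is used only where `V(x) > 0`. -/
def Lam (V w : E d → ℝ) (ρ : ℝ) (x : E d) : ℝ := min 1 (w x / V x ^ ρ)

/-- `sup_{0<|x|≤u} (|f(x)|² ∨ |g(x)|²) / (Λ_ρ(x) V(x)^{2δ}) < ∞` for every `u > 0`. The quotient is
cleared, so that `f` and `g` must vanish wherever the denominator does. -/
def GrowthCond (f : E d → E d) (g : E d → Matrix (Fin d) (Fin m) ℝ) (V w : E d → ℝ)
    (ρ δ : ℝ) : Prop :=
  ∀ u : ℝ, 0 < u → ∃ M : ℝ, ∀ x : E d, 0 < ‖x‖ → ‖x‖ ≤ u →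
    max (‖f x‖ ^ 2) (traceNorm (g x) ^ 2) ≤ M * (Lam V w ρ x * V x ^ (2 * δ))

/-- `φ : (0,∞) → (0,∞)` is strictly increasing, continuous, tends to `∞`, and for all `u ≥ 1`
`sup_{0<|x|≤u} [|f(x)| / (Λ_ρ(x)^{1/2} V(x)^δ) ∨ |g(x)|² / (Λ_ρ(x) V(x)^{2δ})] ≤ φ(u)`
(quotients cleared as above). Values of `φ` outside `(0,∞)` are irrelevant. -/
structure TruncationFun (f : E d → E d) (g : E d → Matrix (Fin d) (Fin m) ℝ) (V w : E d → ℝ)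
    (ρ δ : ℝ) (φ : ℝ → ℝ) : Prop where
  pos : ∀ u, 0 < u → 0 < φ u
  strictMono : StrictMonoOn φ (Set.Ioi 0)
  cont : ContinuousOn φ (Set.Ioi 0)
  tendsto : Tendsto φ atTop atTop
  bound_f : ∀ u, 1 ≤ u → ∀ x : E d, 0 < ‖x‖ → ‖x‖ ≤ u →
    ‖f x‖ ≤ φ u * (Lam V w ρ x ^ (1 / 2 : ℝ) * V x ^ δ)
  bound_g : ∀ u, 1 ≤ u → ∀ x : E d, 0 < ‖x‖ → ‖x‖ ≤ u →
    traceNorm (g x) ^ 2 ≤ φ u * (Lam V w ρ x * V x ^ (2 * δ))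

/-- The truncation radius `φ⁻¹(K Δ^{-θ})`, with `φ⁻¹` the inverse of `φ` on `(0,∞)`. -/
def radius (φ : ℝ → ℝ) (K θ : ℝ) (Δ : ℝ≥0) : ℝ :=
  Function.invFunOn φ (Set.Ioi 0) (K * (Δ : ℝ) ^ (-θ))

/-- The truncation mapping `x ↦ (|x| ∧ r) x/|x|`, with value `0` at `0`. -/
def trunc (r : ℝ) (x : E d) : E d := (min ‖x‖ r / ‖x‖) • x

/-- The `V`-truncated Euler–Maruyama scheme driven by the path increments of `B`:
`Z_0 = x₀`, `Z_{k+1} = π_Δ(Z_k + f(Z_k) Δ + g(Z_k) (B((k+1)Δ) - B(kΔ)))`. -/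
def scheme {Ω : Type*} (f : E d → E d) (g : E d → Matrix (Fin d) (Fin m) ℝ) (φ : ℝ → ℝ)
    (K θ : ℝ) (B : ℝ≥0 → Ω → E m) (x₀ : E d) (Δ : ℝ≥0) : ℕ → Ω → E d
  | 0 => fun _ => x₀
  | k + 1 => fun ω =>
      let z := scheme f g φ K θ B x₀ Δ k ω
      let dB : E m := B (((k + 1 : ℕ) : ℝ≥0) * Δ) ω - B ((k : ℝ≥0) * Δ) ω
      trunc (radius φ K θ Δ) (z + (Δ : ℝ) • f z + WithLp.toLp 2 ((g z).mulVec dB.ofLp))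

/-- `B` is an `m`-dimensional Brownian motion: its components are independent real Brownian
motions. -/
structure IsBrownianMotion {Ω : Type*} [MeasurableSpace Ω] (B : ℝ≥0 → Ω → E m)
    (P : Measure Ω) : Prop where
  measurable : ∀ t, Measurable (B t)
  brownian : ∀ j, IsBrownianReal (fun t ω => B t ω j) P
  indep : iIndepFun (fun (j : Fin m) (ω : Ω) (t : ℝ≥0) => B t ω j) P

end VTruncEM

end

open VTruncEM

/-! ### Taylor expansion along segments and norms of iterated derivatives -/

namespace VTruncEM

/-! The function `V^ρ` is a Lyapunov function for the discrete scheme itself: for small `Δ`, `E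
V^ρ(Z_{k+1}) + (Δ/2) E w(Z_k) ≤ E V^ρ(Z_k)`. Telescoping bounds `∑ E w(Z_k)`, so `w(Z_k) → 0` almost
surely. Truncation keeps the chain in a fixed ball for each `Δ`, so compactness turns this into
convergence to `Ker w`, and `V^ρ(Z_k)` is bounded outright. No supermartingale convergence theorem
is needed.

The one-step inequality (`LyapunovBar.exists_lintegral_step_le`) is a Taylor expansion in the
scale-free variable `|X| / V^δ(z)`, in which the derivatives of `V^ρ` up to order four are all of
size `V^ρ(z)` (`LyapunovBar.exists_norm_iteratedFDeriv_rpow_le`). Averaging over a Gaussian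
increment and its negative removes the odd terms; the second-order term produces `Δ ℒV^ρ ≤ -Δ w`.
Put `h = K Δ^{-θ}`, the value of `φ` at the truncation radius. The growth bounds make every
remaining term at most a constant times `V^ρ Λ (hΔ)²` times a Gaussian moment. Since `V^ρ Λ ≤ w` and
`(hΔ)² = o(Δ)` for `θ < 1/2`, the error costs at most half of `Δ w`. Truncation does not increase
`V`, so the estimate survives it. -/

theorem iteratedDeriv_comp_segment {F : Type*} [NormedAddCommGroup F] [NormedSpace ℝ F]
    {U : F → ℝ} {s : Set F} (hs : IsOpen s) {n : ℕ} (hU : ContDiffOn ℝ n U s) (z X : F) {t : ℝ}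
    (ht : z + t • X ∈ s) :
    iteratedDeriv n (fun t : ℝ => U (z + t • X)) t
      = iteratedFDeriv ℝ n U (z + t • X) (fun _ => X) := by
  set L : ℝ →L[ℝ] F := ContinuousLinearMap.toSpanSingleton ℝ X with hL
  have hLt : ∀ t : ℝ, L t = t • X := fun t => by simp [hL]
  set s' : Set F := (fun y => z + y) ⁻¹' s with hs'
  have hs'o : IsOpen s' := hs.preimage (by fun_prop)
  have hU' : ContDiffOn ℝ n (fun y => U (z + y)) s' :=
    hU.comp (by fun_prop) (fun y hy => hy)
  have ho : IsOpen (L ⁻¹' s') := hs'o.preimage L.continuous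
  have htm : L t ∈ s' := by simpa [hs', hLt] using ht
  have key := L.iteratedFDerivWithin_comp_right hU' hs'o.uniqueDiffOn ho.uniqueDiffOn htm
    (i := n) le_rfl
  rw [iteratedFDerivWithin_of_isOpen n ho htm, iteratedFDerivWithin_of_isOpen n hs'o htm,
    iteratedFDeriv_comp_add_left] at key
  have hc : (fun t : ℝ => U (z + t • X)) = (fun y => U (z + y)) ∘ L := by
    ext t; simp [hLt]
  rw [iteratedDeriv_eq_iteratedFDeriv, hc, key]
  simp [hLt]

/-- The Lagrange remainder of the restriction to the segment, with the factorial dropped. Smoothness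
is asked only on an open set containing the segment, because `V^ρ` may be singular at the origin. -/
theorem abs_sub_taylor_segment_le {F : Type*} [NormedAddCommGroup F] [NormedSpace ℝ F]
    {U : F → ℝ} {s : Set F} (hs : IsOpen s) {n : ℕ} (hU : ContDiffOn ℝ (n + 1 : ℕ) U s) {z X : F}
    (hzX : ∀ t ∈ Set.Icc (0 : ℝ) 1, z + t • X ∈ s) {M : ℝ}
    (hM : ∀ t ∈ Set.Icc (0 : ℝ) 1, ‖iteratedFDeriv ℝ (n + 1) U (z + t • X)‖ ≤ M) :
    |U (z + X) - ∑ k ∈ Finset.range (n + 1),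
      ((k.factorial : ℝ)⁻¹) * iteratedFDeriv ℝ k U z (fun _ => X)| ≤ M * ‖X‖ ^ (n + 1) := by
  set φ : ℝ → ℝ := fun t => U (z + t • X) with hφ
  have hat : ∀ t ∈ Set.Icc (0 : ℝ) 1, ContDiffAt ℝ (n + 1 : ℕ) φ t := fun t ht => by
    have h1 : ContDiffAt ℝ (n + 1 : ℕ) U (z + t • X) := hU.contDiffAt (hs.mem_nhds (hzX t ht))
    exact h1.comp t (by fun_prop)
  have huIcc : Set.uIcc (0 : ℝ) 1 = Set.Icc 0 1 := Set.uIcc_of_le zero_le_one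
  have hon : ContDiffOn ℝ (n + 1 : ℕ) φ (Set.uIcc 0 1) := by
    rw [huIcc]; exact fun t ht => (hat t ht).contDiffWithinAt
  obtain ⟨t, ht, h⟩ := taylor_mean_remainder_lagrange_iteratedDeriv (f := φ) (n := n)
    (zero_ne_one (α := ℝ)) (by exact_mod_cast hon)
  have ht' : t ∈ Set.Icc (0 : ℝ) 1 := by
    rw [← huIcc]; exact Set.uIoo_subset_uIcc_self ht
  have h0 : (0 : ℝ) ∈ Set.Icc (0 : ℝ) 1 := by simp
  have hsum : taylorWithinEval φ n (Set.uIcc 0 1) 0 1 = ∑ k ∈ Finset.range (n + 1),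
      ((k.factorial : ℝ)⁻¹) * iteratedFDeriv ℝ k U z (fun _ => X) := by
    rw [taylor_within_apply]
    refine Finset.sum_congr rfl fun k hk => ?_
    have hkn : (k : WithTop ℕ∞) ≤ (n + 1 : ℕ) := by
      exact_mod_cast (Finset.mem_range.1 hk).le
    have := iteratedDeriv_comp_segment hs (hU.of_le hkn) z X (hzX 0 h0)
    rw [huIcc, iteratedDerivWithin_eq_iteratedDeriv (uniqueDiffOn_Icc zero_lt_one)
      ((hat 0 h0).of_le hkn) h0, hφ, this]
    simp
  rw [hsum, iteratedDeriv_comp_segment hs hU z X (hzX t ht')] at h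
  have h1 : φ 1 = U (z + X) := by simp [hφ]
  rw [← h1, h, sub_zero, one_pow, mul_one, abs_div]
  have hle := (iteratedFDeriv ℝ (n + 1) U (z + t • X)).le_opNorm (fun _ => X)
  rw [Finset.prod_const, Finset.card_univ, Fintype.card_fin, Real.norm_eq_abs] at hle
  have hf : (1 : ℝ) ≤ |((n + 1).factorial : ℝ)| := by
    rw [Nat.abs_cast]; exact_mod_cast Nat.one_le_iff_ne_zero.2 (Nat.factorial_ne_zero _)
  calc _ ≤ |iteratedFDeriv ℝ (n + 1) U (z + t • X) fun _ => X| :=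
        div_le_self (abs_nonneg _) hf
    _ ≤ _ := hle.trans (by gcongr; exact hM t ht')

/-- Multilinear expansion in the standard basis has `d^n` terms, each with a coefficient bounded by
the Euclidean norm of the array of partial derivatives. -/
theorem norm_iteratedFDeriv_le_normD {d : ℕ} (n : ℕ) (V : E d → ℝ) (x : E d) :
    ‖iteratedFDeriv ℝ n V x‖ ≤ (d : ℝ) ^ n * normD n V x := by
  have hD : 0 ≤ normD n V x := Real.sqrt_nonneg _
  refine ContinuousMultilinearMap.opNorm_le_bound (by positivity) fun v => ?_
  have hv : v = fun k => ∑ i, v k i • EuclideanSpace.single i (1 : ℝ) := by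
    funext k
    have := (EuclideanSpace.basisFun (Fin d) ℝ).sum_repr (v k)
    simpa using this.symm
  have hexp : iteratedFDeriv ℝ n V x v =
      ∑ ι : Fin n → Fin d, (∏ k, v k (ι k)) * partialDeriv n V x ι := by
    conv_lhs => rw [hv]
    rw [ContinuousMultilinearMap.map_sum]
    refine Finset.sum_congr rfl fun ι _ => ?_
    rw [ContinuousMultilinearMap.map_smul_univ]
    rfl
  rw [hexp]
  refine (norm_sum_le _ _).trans ?_
  have : ∀ ι ∈ (Finset.univ : Finset (Fin n → Fin d)),
      ‖(∏ k, v k (ι k)) * partialDeriv n V x ι‖ ≤ normD n V x * ∏ k, ‖v k‖ := fun ι _ => by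
    rw [norm_mul, mul_comm, norm_prod]
    refine mul_le_mul ?_ ?_ (by positivity) hD
    · rw [Real.norm_eq_abs]
      refine Real.abs_le_sqrt ?_
      exact Finset.single_le_sum (f := fun ι => partialDeriv n V x ι ^ 2)
        (fun _ _ => sq_nonneg _) (Finset.mem_univ ι)
    · exact Finset.prod_le_prod (fun _ _ => norm_nonneg _) fun k _ => PiLp.norm_apply_le (v k) (ι k)
  refine (Finset.sum_le_card_nsmul _ _ _ this).trans (le_of_eq ?_)
  simp [mul_assoc]

end VTruncEM

/-! ### Derivative bounds for powers of `V` -/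

namespace VTruncEM

variable {d : ℕ} {V : E d → ℝ} {p : ℕ} {δ : ℝ}

theorem LyapunovBar.pos (hV : LyapunovBar p δ V) {x : E d} (hx : x ≠ 0) : 0 < V x :=
  (hV.nonneg x).lt_of_ne fun h => hx (by
    have : x ∈ {x | V x = 0} := h.symm
    rwa [hV.ker] at this)

theorem LyapunovBar.map_zero (hV : LyapunovBar p δ V) : V 0 = 0 := by
  have : (0 : E d) ∈ {x | V x = 0} := by rw [hV.ker]; rfl
  exact this

theorem LyapunovBar.exists_norm_iteratedFDeriv_le (hV : LyapunovBar p δ V) :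
    ∃ c : ℝ, 1 ≤ c ∧ ∀ n, 1 ≤ n → n ≤ p → ∀ x,
      ‖iteratedFDeriv ℝ n V x‖ ≤ c * V x ^ (1 - n * δ) := by
  obtain ⟨c, hc, h⟩ := hV.bound
  -- The summand `1` secures `1 ≤ c`, so that `c` can later be replaced by `c ^ i`.
  refine ⟨1 + ∑ n ∈ Finset.Icc 1 p, (d : ℝ) ^ n * c, ?_, fun n h1 h2 x => ?_⟩
  · have : 0 ≤ ∑ n ∈ Finset.Icc 1 p, (d : ℝ) ^ n * c := Finset.sum_nonneg fun _ _ => by positivity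
    linarith
  have hn : n ∈ Finset.Icc 1 p := Finset.mem_Icc.2 ⟨h1, h2⟩
  have hle : (d : ℝ) ^ n * c ≤ 1 + ∑ n ∈ Finset.Icc 1 p, (d : ℝ) ^ n * c := by
    have := Finset.single_le_sum (f := fun n : ℕ => (d : ℝ) ^ n * c)
      (fun _ _ => by positivity) hn
    linarith
  calc _ ≤ (d : ℝ) ^ n * normD n V x := norm_iteratedFDeriv_le_normD n V x
    _ ≤ (d : ℝ) ^ n * (c * V x ^ (1 - n * δ)) := by gcongr; exact h n hn x
    _ = ((d : ℝ) ^ n * c) * V x ^ (1 - n * δ) := by ring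
    _ ≤ _ := mul_le_mul_of_nonneg_right hle (Real.rpow_nonneg (hV.nonneg x) _)

/-- Normalise by `v = V x`: the function `V / v` equals `1` at `x`, so the derivatives of `y ↦ y^ρ`
enter only at `1` and are constants, while the `i`-th derivative of `V / v` is at most `(c
v^{-δ})^i`. This geometric form is what the Faà di Bruno bound requires; homogeneity restores the
factor `v^ρ`. -/
theorem LyapunovBar.exists_norm_iteratedFDeriv_rpow_le (hV : LyapunovBar p δ V) (ρ : ℝ) :
    ∃ C : ℝ, 0 < C ∧ ∀ n ≤ p, ∀ x ≠ 0,
      ‖iteratedFDeriv ℝ n (fun y => V y ^ ρ) x‖ ≤ C * V x ^ (ρ - n * δ) := by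
  obtain ⟨c, hc1, hc⟩ := hV.exists_norm_iteratedFDeriv_le
  set G : ℝ := 1 + ∑ i ∈ Finset.range (p + 1),
    ‖iteratedFDerivWithin ℝ i (fun y : ℝ => y ^ ρ) (Set.Ioi 0) 1‖ with hG
  have hG0 : 1 ≤ G := by
    have : 0 ≤ ∑ i ∈ Finset.range (p + 1),
      ‖iteratedFDerivWithin ℝ i (fun y : ℝ => y ^ ρ) (Set.Ioi 0) 1‖ :=
      Finset.sum_nonneg fun _ _ => norm_nonneg _
    linarith
  have hGi : ∀ i ≤ p, ‖iteratedFDerivWithin ℝ i (fun y : ℝ => y ^ ρ) (Set.Ioi 0) 1‖ ≤ G :=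
    fun i hi => by
      have := Finset.single_le_sum
        (f := fun i => ‖iteratedFDerivWithin ℝ i (fun y : ℝ => y ^ ρ) (Set.Ioi 0) 1‖)
        (fun _ _ => norm_nonneg _) (Finset.mem_range.2 (Nat.lt_succ_of_le hi))
      linarith
  refine ⟨p.factorial * G * c ^ p, by positivity, fun n hn x hx => ?_⟩
  have hv : 0 < V x := hV.pos hx
  set v := V x with hvdef
  set s : Set (E d) := {0}ᶜ
  have hs : IsOpen s := isOpen_compl_singleton
  have hxs : x ∈ s := hx
  have hrpow : ContDiffOn ℝ p (fun y : ℝ => y ^ ρ) (Set.Ioi 0) := fun y hy =>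
    (Real.contDiffAt_rpow_const_of_ne (ne_of_gt hy)).contDiffWithinAt
  have hf : ContDiff ℝ p (fun y => v⁻¹ • V y) := hV.contDiff.const_smul _
  have hD : ∀ i, 1 ≤ i → i ≤ n →
      ‖iteratedFDerivWithin ℝ i (fun y => v⁻¹ • V y) s x‖ ≤ (c * v ^ (-δ)) ^ i := by
    intro i h1 h2
    rw [iteratedFDerivWithin_of_isOpen i hs hxs,
      iteratedFDeriv_const_smul_apply' (hV.contDiff.contDiffAt.of_le
        (by exact_mod_cast h2.trans hn)), norm_smul, norm_inv, Real.norm_of_nonneg hv.le]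
    calc v⁻¹ * ‖iteratedFDeriv ℝ i V x‖ ≤ v⁻¹ * (c * v ^ (1 - i * δ)) := by
          gcongr; exact hc i h1 (h2.trans hn) x
      _ = c * (v ^ (-δ)) ^ i := by
          rw [← Real.rpow_natCast (v ^ (-δ)), ← Real.rpow_mul hv.le, Real.rpow_sub hv,
            Real.rpow_one, neg_mul, Real.rpow_neg hv.le, mul_comm δ]
          field_simp
      _ ≤ c ^ i * (v ^ (-δ)) ^ i := by
          gcongr
          exact le_self_pow₀ hc1 (by omega)
      _ = _ := (mul_pow _ _ _).symm
  have hst : Set.MapsTo (fun y => v⁻¹ • V y) s (Set.Ioi 0) := fun y hy => by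
    have := hV.pos (x := y) hy
    simp only [Set.mem_Ioi, smul_eq_mul]; positivity
  have hone : v⁻¹ • V x = 1 := by simp [← hvdef, hv.ne']
  have key := norm_iteratedFDerivWithin_comp_le hrpow hf.contDiffOn (n := n) (by exact_mod_cast hn)
    (uniqueDiffOn_Ioi 0) hs.uniqueDiffOn hst hxs
    (C := G) (fun i hi => by rw [hone]; exact hGi i (hi.trans hn)) hD
  have hcomp : Set.EqOn (fun y => V y ^ ρ)
      (fun y => v ^ ρ • (((fun y : ℝ => y ^ ρ) ∘ fun y => v⁻¹ • V y) y)) s := fun y _ => by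
    simp only [Function.comp_apply, smul_eq_mul]
    rw [Real.mul_rpow (by positivity) (hV.nonneg y), Real.inv_rpow hv.le, ← mul_assoc,
      mul_inv_cancel₀ (Real.rpow_pos_of_pos hv ρ).ne', one_mul]
  have hcd : ContDiffWithinAt ℝ n ((fun y : ℝ => y ^ ρ) ∘ fun y => v⁻¹ • V y) s x :=
    ((hrpow.comp hf.contDiffOn hst).of_le (by exact_mod_cast hn)) x hxs
  have hsmul := iteratedFDerivWithin_const_smul_apply (a := v ^ ρ) hcd hs.uniqueDiffOn hxs
  rw [← iteratedFDerivWithin_of_isOpen n hs hxs, iteratedFDerivWithin_congr hcomp hxs]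
  refine (congrArg norm hsmul).trans_le ?_
  rw [norm_smul,
    Real.norm_of_nonneg (Real.rpow_nonneg hv.le ρ)]
  calc _ ≤ v ^ ρ * (n.factorial * G * (c * v ^ (-δ)) ^ n) := by gcongr
    _ = n.factorial * G * c ^ n * v ^ (ρ - n * δ) := by
        rw [mul_pow, ← Real.rpow_natCast (v ^ (-δ)), ← Real.rpow_mul hv.le, Real.rpow_sub hv,
          neg_mul, Real.rpow_neg hv.le, mul_comm δ]
        field_simp
    _ ≤ _ := by
        gcongr

/-- Formally `|D V^δ| = δ V^{δ-1} |DV| ≤ δ c`. Since `V^δ` need not be differentiable at the origin,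
the mean value inequality is applied to `(V + ε)^δ`, with a bound uniform in `ε`, and then `ε → 0`.
-/
theorem LyapunovBar.exists_abs_rpow_sub_le (hV : LyapunovBar p δ V) (hp : 1 ≤ p) (hδ0 : 0 < δ)
    (hδ1 : δ ≤ 1) : ∃ L : ℝ, 0 < L ∧ ∀ x y, |V x ^ δ - V y ^ δ| ≤ L * ‖x - y‖ := by
  obtain ⟨c, hc1, hc⟩ := hV.exists_norm_iteratedFDeriv_le
  refine ⟨c, by linarith, fun x y => ?_⟩
  have hdiff : Differentiable ℝ V := hV.contDiff.differentiable (by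
    simpa using Nat.one_le_iff_ne_zero.1 hp)
  have hε : ∀ ε : ℝ, 0 < ε → |(V x + ε) ^ δ - (V y + ε) ^ δ| ≤ c * ‖x - y‖ := by
    intro ε hε
    have hpos : ∀ z, 0 < V z + ε := fun z => by have := hV.nonneg z; linarith
    have hd : ∀ z, HasFDerivAt (fun z => (V z + ε) ^ δ)
        ((δ * (V z + ε) ^ (δ - 1)) • fderiv ℝ V z) z := fun z =>
      ((hdiff z).hasFDerivAt.add_const ε).rpow_const (Or.inl (hpos z).ne')
    refine Convex.norm_image_sub_le_of_norm_hasFDerivWithin_le (s := Set.univ)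
      (fun z _ => (hd z).hasFDerivWithinAt) (fun z _ => ?_) convex_univ (Set.mem_univ y)
      (Set.mem_univ x)
    have h1 : ‖fderiv ℝ V z‖ ≤ c * V z ^ (1 - δ) := by
      have := hc 1 le_rfl hp z
      rwa [norm_iteratedFDeriv_one, Nat.cast_one, one_mul] at this
    have h2 : V z ^ (1 - δ) ≤ (V z + ε) ^ (1 - δ) :=
      Real.rpow_le_rpow (hV.nonneg z) (by linarith) (by linarith)
    have h3 : 0 < (V z + ε) ^ (δ - 1) := Real.rpow_pos_of_pos (hpos z) _
    rw [norm_smul, Real.norm_of_nonneg (by positivity)]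
    calc _ ≤ δ * (V z + ε) ^ (δ - 1) * (c * (V z + ε) ^ (1 - δ)) := by
          gcongr; exact h1.trans (by gcongr)
      _ = δ * c := by
          have : (V z + ε) ^ (δ - 1) * (V z + ε) ^ (1 - δ) = 1 := by
            rw [← Real.rpow_add (hpos z)]; simp
          linear_combination δ * c * this
      _ ≤ 1 * c := by gcongr
      _ = c := one_mul c
  have hcont : Continuous fun ε : ℝ => |(V x + ε) ^ δ - (V y + ε) ^ δ| := by
    have h (z : E d) : Continuous fun ε : ℝ => (V z + ε) ^ δ :=
      (continuous_const.add continuous_id).rpow_const fun _ => Or.inr hδ0.le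
    exact ((h x).sub (h y)).abs
  have ht : Tendsto (fun ε : ℝ => |(V x + ε) ^ δ - (V y + ε) ^ δ|) (𝓝[>] 0)
      (𝓝 |V x ^ δ - V y ^ δ|) := by
    simpa using (hcont.tendsto 0).mono_left nhdsWithin_le_nhds
  exact le_of_tendsto ht (eventually_mem_nhdsWithin.mono hε)

end VTruncEM

/-! ### One-step Taylor estimates for `V^ρ` -/

namespace VTruncEM

variable {d : ℕ} {V : E d → ℝ} {p : ℕ} {δ : ℝ}

theorem rpow_le_two_rpow_abs_mul {a b : ℝ} (ha : 0 < a) (h1 : a / 2 ≤ b) (h2 : b ≤ 2 * a) (r : ℝ) :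
    b ^ r ≤ 2 ^ |r| * a ^ r := by
  have hb : 0 < b := by linarith
  rcases le_total 0 r with hr | hr
  · rw [abs_of_nonneg hr, ← Real.mul_rpow (by norm_num) ha.le]
    exact Real.rpow_le_rpow hb.le h2 hr
  · rw [abs_of_nonpos hr, Real.rpow_neg (by norm_num), ← Real.inv_rpow (by norm_num),
      ← Real.mul_rpow (by norm_num) ha.le]
    exact Real.rpow_le_rpow_of_nonpos (by positivity) (by linarith) hr

/-- With `t = ‖X‖ / V(z)^δ` and `L` the Lipschitz constant of `V^δ`, there are two regimes. If `2Lt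
≤ 1`, then `V^δ` stays within a factor two of its value at `z` along the segment, which therefore
misses the origin, and Taylor's formula applies. If `2Lt > 1`, Lipschitz growth of `V^δ` bounds the
left side by a multiple of `t^q`. -/
theorem LyapunovBar.exists_rpow_le_taylor (hV : LyapunovBar 4 δ V) (hδ0 : 0 < δ) (hδ1 : δ ≤ 1)
    {ρ : ℝ} (hρ : 0 < ρ) : ∃ (C : ℝ) (q : ℕ), 0 < C ∧ 4 ≤ q ∧ ∀ z ≠ 0, ∀ X,
      V (z + X) ^ ρ ≤ ∑ k ∈ Finset.range 4,
          ((k.factorial : ℝ)⁻¹) * iteratedFDeriv ℝ k (fun y => V y ^ ρ) z (fun _ => X)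
        + C * V z ^ ρ * ((‖X‖ / V z ^ δ) ^ 4 + (‖X‖ / V z ^ δ) ^ q) := by
  obtain ⟨C₀, hC₀, hD⟩ := hV.exists_norm_iteratedFDeriv_rpow_le ρ
  obtain ⟨L, hL, hLip⟩ := hV.exists_abs_rpow_sub_le (by norm_num) hδ0 hδ1
  -- `q ≥ ρ/δ` dominates the growth of `V^ρ = (V^δ)^{ρ/δ}`; `r` is the exponent of `V^δ` in
  -- `V^{ρ-4δ}`.
  set q : ℕ := max 4 ⌈ρ / δ⌉₊ with hq
  set r : ℝ := ρ / δ - 4 with hr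
  have hq4 : 4 ≤ q := le_max_left _ _
  have hqρ : ρ / δ ≤ q := (Nat.le_ceil _).trans (by exact_mod_cast le_max_right _ _)
  -- The three summands pay for the Taylor remainder, for the growth of `V^ρ` under large
  -- increments, and for the four polynomial terms when these are negative.
  refine ⟨C₀ * 2 ^ |r| + (3 * L) ^ q + 4 * (C₀ * (2 * L + 1) ^ 4), q, by positivity, hq4,
    fun z hz X => ?_⟩
  have hv : 0 < V z := hV.pos hz
  have hvδ : 0 < V z ^ δ := Real.rpow_pos_of_pos hv δ
  have hvρ : 0 < V z ^ ρ := Real.rpow_pos_of_pos hv ρ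
  set t : ℝ := ‖X‖ / V z ^ δ with ht
  have ht0 : 0 ≤ t := by positivity
  have hX : ‖X‖ = t * V z ^ δ := by rw [ht]; field_simp
  have hpow (y : E d) (s : ℝ) : V y ^ s = (V y ^ δ) ^ (s / δ) := by
    rw [← Real.rpow_mul (hV.nonneg y)]; congr 1; field_simp
  have hscale (k : ℕ) : V z ^ (ρ - k * δ) * ‖X‖ ^ k = V z ^ ρ * t ^ k := by
    rw [hX, mul_pow, ← Real.rpow_natCast (V z ^ δ), ← Real.rpow_mul hv.le, Real.rpow_sub hv,
      mul_comm δ]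
    field_simp
  have hkq : ∀ c₁ c₂ c₃ : ℝ, 0 ≤ c₁ → 0 ≤ c₂ → 0 ≤ c₃ →
      c₁ * t ^ 4 + c₂ * t ^ q + c₃ * t ^ 4 ≤ (c₁ + c₂ + c₃) * (t ^ 4 + t ^ q) := by
    intro c₁ c₂ c₃ h1 h2 h3
    have := pow_nonneg ht0 4
    have := pow_nonneg ht0 q
    nlinarith [mul_nonneg h1 (pow_nonneg ht0 q), mul_nonneg h2 (pow_nonneg ht0 4),
      mul_nonneg h3 (pow_nonneg ht0 q)]
  rcases le_or_gt (2 * L * t) 1 with hsmall | hlarge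
  · have hseg : ∀ s ∈ Set.Icc (0 : ℝ) 1, V z ^ δ / 2 ≤ V (z + s • X) ^ δ ∧
        V (z + s • X) ^ δ ≤ 2 * V z ^ δ := by
      rintro s ⟨hs0, hs1⟩
      have h1 := hLip (z + s • X) z
      rw [add_sub_cancel_left, norm_smul, Real.norm_of_nonneg hs0] at h1
      have h2 : L * (s * ‖X‖) ≤ V z ^ δ / 2 := by
        rw [hX]
        calc L * (s * (t * V z ^ δ)) ≤ L * (1 * (t * V z ^ δ)) := by gcongr
          _ = (2 * L * t) * (V z ^ δ / 2) := by ring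
          _ ≤ 1 * (V z ^ δ / 2) := by gcongr
          _ = _ := one_mul _
      have h3 := abs_le.1 (h1.trans h2)
      constructor <;> linarith [h3.1, h3.2]
    have hne : ∀ s ∈ Set.Icc (0 : ℝ) 1, z + s • X ∈ ({0}ᶜ : Set (E d)) := by
      intro s hs h0
      have h1 := (hseg s hs).1
      rw [Set.mem_singleton_iff.1 h0, hV.map_zero, Real.zero_rpow hδ0.ne'] at h1
      linarith
    have hU : ContDiffOn ℝ (3 + 1 : ℕ) (fun y => V y ^ ρ) {0}ᶜ := fun y hy =>
      (hV.contDiff.contDiffAt.rpow_const_of_ne (hV.pos hy).ne').contDiffWithinAt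
    have key := abs_sub_taylor_segment_le isOpen_compl_singleton hU hne
      (M := C₀ * (2 ^ |r| * V z ^ (ρ - (4 : ℕ) * δ))) (fun s hs => by
        refine (hD 4 le_rfl _ (hne s hs)).trans ?_
        gcongr
        have he : (ρ - (4 : ℕ) * δ) / δ = r := by rw [hr]; push_cast; field_simp
        rw [hpow (z + s • X), hpow z, he]
        exact rpow_le_two_rpow_abs_mul hvδ (hseg s hs).1 (hseg s hs).2 r)
    have h4 : C₀ * (2 ^ |r| * V z ^ (ρ - (4 : ℕ) * δ)) * ‖X‖ ^ (3 + 1)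
        = V z ^ ρ * (C₀ * 2 ^ |r| * t ^ 4) := by
      linear_combination (C₀ * 2 ^ |r|) * hscale 4
    rw [h4] at key
    have h5 := (abs_le.1 key).2
    have h6 := mul_le_mul_of_nonneg_left (hkq (C₀ * 2 ^ |r|) ((3 * L) ^ q)
      (4 * (C₀ * (2 * L + 1) ^ 4)) (by positivity) (by positivity) (by positivity)) hvρ.le
    have h7 : V z ^ ρ * (C₀ * 2 ^ |r| * t ^ 4) ≤ V z ^ ρ * (C₀ * 2 ^ |r| * t ^ 4 +
      (3 * L) ^ q * t ^ q + 4 * (C₀ * (2 * L + 1) ^ 4) * t ^ 4) := by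
      gcongr
      have : 0 ≤ (3 * L) ^ q * t ^ q + 4 * (C₀ * (2 * L + 1) ^ 4) * t ^ 4 := by positivity
      linarith
    linarith
  · have hup : V (z + X) ^ ρ ≤ V z ^ ρ * ((3 * L) ^ q * t ^ q) := by
      have h1 := hLip (z + X) z
      rw [add_sub_cancel_left, hX] at h1
      have h2 : V (z + X) ^ δ ≤ V z ^ δ * (1 + L * t) := by linarith [(abs_le.1 h1).2]
      calc V (z + X) ^ ρ = (V (z + X) ^ δ) ^ (ρ / δ) := hpow _ _
        _ ≤ (V z ^ δ * (1 + L * t)) ^ (ρ / δ) :=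
            Real.rpow_le_rpow (Real.rpow_nonneg (hV.nonneg _) _) h2 (by positivity)
        _ = V z ^ ρ * (1 + L * t) ^ (ρ / δ) := by
            rw [Real.mul_rpow hvδ.le (by positivity), ← hpow]
        _ ≤ V z ^ ρ * (1 + L * t) ^ (q : ℝ) := by
            gcongr
            linarith [mul_nonneg hL.le ht0]
        _ ≤ V z ^ ρ * (3 * L * t) ^ q := by
            rw [Real.rpow_natCast]
            gcongr
            linarith
        _ = _ := by rw [mul_pow]
    -- The Taylor terms may be negative; as `(2L+1)t ≥ 1` here, lower powers of `t` are absorbed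
    -- into `t^4`.
    have hterm : ∀ k ∈ Finset.range 4, -(V z ^ ρ * (C₀ * (2 * L + 1) ^ 4 * t ^ 4)) ≤
        ((k.factorial : ℝ)⁻¹) * iteratedFDeriv ℝ k (fun y => V y ^ ρ) z (fun _ => X) := by
      intro k hk
      have hk4 : k < 4 := Finset.mem_range.1 hk
      have h1 := (iteratedFDeriv ℝ k (fun y => V y ^ ρ) z).le_opNorm (fun _ => X)
      rw [Finset.prod_const, Finset.card_univ, Fintype.card_fin, Real.norm_eq_abs] at h1
      have hf : ((k.factorial : ℝ)⁻¹) ≤ 1 := by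
        refine inv_le_one_of_one_le₀ ?_
        exact_mod_cast Nat.one_le_iff_ne_zero.2 (Nat.factorial_ne_zero _)
      have h2 : t ^ k ≤ (2 * L + 1) ^ 4 * t ^ 4 := by
        have hone : 1 ≤ (2 * L + 1) * t := by linarith
        calc t ^ k = t ^ k * 1 := (mul_one _).symm
          _ ≤ t ^ k * ((2 * L + 1) * t) ^ (4 - k) := by
              gcongr; exact one_le_pow₀ hone
          _ = (2 * L + 1) ^ (4 - k) * t ^ 4 := by
              rw [mul_pow, mul_left_comm, ← pow_add, Nat.add_sub_cancel' hk4.le]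
          _ ≤ _ := by
              gcongr
              · linarith
              · omega
      have h3 : |((k.factorial : ℝ)⁻¹) *
          iteratedFDeriv ℝ k (fun y => V y ^ ρ) z (fun _ => X)| ≤
          V z ^ ρ * (C₀ * (2 * L + 1) ^ 4 * t ^ 4) := by
        rw [abs_mul, abs_of_nonneg (by positivity : (0 : ℝ) ≤ (k.factorial : ℝ)⁻¹)]
        calc _ ≤ 1 * ((C₀ * V z ^ (ρ - k * δ)) * ‖X‖ ^ k) := by
              gcongr
              exact h1.trans (by gcongr; exact hD k hk4.le z hz)
          _ = C₀ * (V z ^ ρ * t ^ k) := by rw [← hscale k]; ring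
          _ ≤ C₀ * (V z ^ ρ * ((2 * L + 1) ^ 4 * t ^ 4)) := by gcongr
          _ = _ := by ring
      exact (abs_le.1 h3).1
    have hsum := Finset.card_nsmul_le_sum _ _ _ hterm
    rw [Finset.card_range, nsmul_eq_mul] at hsum
    have h6 := mul_le_mul_of_nonneg_left (hkq (C₀ * 2 ^ |r|) ((3 * L) ^ q)
      (4 * (C₀ * (2 * L + 1) ^ 4)) (by positivity) (by positivity) (by positivity)) hvρ.le
    have h7 : 0 ≤ V z ^ ρ * (C₀ * 2 ^ |r| * t ^ 4) := by positivity
    push_cast at hsum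
    linarith

/-- The pure `b` contributions cancel by oddness of a cubic form, so it suffices to compare the
values at `a ± b` with those at `±b`; each difference carries a factor `‖a‖`. -/
theorem abs_apply_add_add_apply_sub_le {F : Type*} [NormedAddCommGroup F] [NormedSpace ℝ F]
    (T : F [×3]→L[ℝ] ℝ) (a b : F) :
    |T (fun _ => a + b) + T (fun _ => a - b)| ≤ 6 * ‖T‖ * ((‖a‖ + ‖b‖) ^ 2 * ‖a‖) := by
  have hodd : T (fun _ => -b) = - T (fun _ => b) := by
    have := T.map_smul_univ (fun _ => (-1 : ℝ)) (fun _ => b)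
    simpa [pow_succ] using this
  have hdiff : ∀ c : F, ‖c‖ = ‖b‖ →
      |T (fun _ => a + c) - T (fun _ => c)| ≤ 3 * ‖T‖ * ((‖a‖ + ‖b‖) ^ 2 * ‖a‖) := by
    intro c hc
    have h := T.norm_image_sub_le (fun _ => a + c) (fun _ => c)
    have hmax : max ‖(fun _ : Fin 3 => a + c)‖ ‖(fun _ : Fin 3 => c)‖ ≤ ‖a‖ + ‖b‖ := by
      rw [pi_norm_const, pi_norm_const]
      refine max_le ((norm_add_le _ _).trans (by rw [hc])) ?_
      rw [hc]; exact le_add_of_nonneg_left (norm_nonneg _)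
    have hsub : ‖(fun _ : Fin 3 => a + c) - (fun _ : Fin 3 => c)‖ = ‖a‖ := by
      have : (fun _ : Fin 3 => a + c) - (fun _ : Fin 3 => c) = fun _ => a := by
        funext i; simp
      rw [this, pi_norm_const]
    rw [hsub, Fintype.card_fin, Real.norm_eq_abs] at h
    refine h.trans ?_
    calc _ ≤ ‖T‖ * (3 : ℕ) * (‖a‖ + ‖b‖) ^ (3 - 1) * ‖a‖ := by gcongr
      _ = _ := by norm_num; ring
  have h1 := hdiff b rfl
  have h2 := hdiff (-b) (norm_neg b)
  rw [hodd, ← sub_eq_add_neg] at h2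
  have := abs_add_le (T (fun _ => a + b) - T (fun _ => b)) (T (fun _ => a - b) - -T (fun _ => b))
  have he : (T (fun _ => a + b) - T (fun _ => b)) + (T (fun _ => a - b) - -T (fun _ => b))
    = T (fun _ => a + b) + T (fun _ => a - b) := by ring
  rw [he] at this
  linarith

/-- Averaging over `±b` pointwise, before any integration, cancels the terms linear in `b`, the
mixed second-order terms and the leading cubic term. Here `a` will be the drift increment and `b`
the noise. -/
theorem LyapunovBar.exists_rpow_symm_le (hV : LyapunovBar 4 δ V) (hδ0 : 0 < δ) (hδ1 : δ ≤ 1)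
    {ρ : ℝ} (hρ : 0 < ρ) : ∃ (C : ℝ) (q : ℕ), 0 < C ∧ 4 ≤ q ∧ ∀ z ≠ 0, ∀ a b, ∀ α β : ℝ,
      ‖a‖ ≤ α * V z ^ δ → ‖b‖ ≤ β * V z ^ δ →
      (V (z + (a + b)) ^ ρ + V (z + (a - b)) ^ ρ) / 2 ≤
        V z ^ ρ + fderiv ℝ (fun y => V y ^ ρ) z a
          + 1 / 2 * fderiv ℝ (fderiv ℝ (fun y => V y ^ ρ)) z b b
          + C * V z ^ ρ * (α ^ 2 + (α + β) ^ 2 * α + (α + β) ^ 4 + (α + β) ^ q) := by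
  obtain ⟨C₁, q, hC₁, hq, hT⟩ := hV.exists_rpow_le_taylor hδ0 hδ1 hρ
  obtain ⟨C₀, hC₀, hD⟩ := hV.exists_norm_iteratedFDeriv_rpow_le ρ
  refine ⟨C₁ + C₀, q, by positivity, hq, fun z hz a b α β ha hb => ?_⟩
  have hv : 0 < V z := hV.pos hz
  have hvδ : 0 < V z ^ δ := Real.rpow_pos_of_pos hv δ
  have hvρ : 0 < V z ^ ρ := Real.rpow_pos_of_pos hv ρ
  have hα : 0 ≤ α := nonneg_of_mul_nonneg_left ((norm_nonneg a).trans ha) hvδ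
  have hβ : 0 ≤ β := nonneg_of_mul_nonneg_left ((norm_nonneg b).trans hb) hvδ
  set U : E d → ℝ := fun y => V y ^ ρ with hU
  have hUz : U z = V z ^ ρ := rfl
  have hscale (k : ℕ) : V z ^ (ρ - k * δ) * (V z ^ δ) ^ k = V z ^ ρ := by
    rw [← Real.rpow_natCast (V z ^ δ), ← Real.rpow_mul hv.le, Real.rpow_sub hv, mul_comm δ]
    field_simp
  have hrem : ∀ X : E d, ‖X‖ ≤ (α + β) * V z ^ δ →
      C₁ * V z ^ ρ * ((‖X‖ / V z ^ δ) ^ 4 + (‖X‖ / V z ^ δ) ^ q) ≤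
      C₁ * V z ^ ρ * ((α + β) ^ 4 + (α + β) ^ q) := by
    intro X hX
    have : ‖X‖ / V z ^ δ ≤ α + β := (div_le_iff₀ hvδ).2 hX
    gcongr
  have hp := (hT z hz (a + b)).trans (add_le_add_right (hrem (a + b)
    ((norm_add_le _ _).trans (by linarith))) _)
  have hm := (hT z hz (a - b)).trans (add_le_add_right (hrem (a - b)
    ((norm_sub_le _ _).trans (by linarith))) _)
  simp only [Finset.sum_range_succ, Finset.sum_range_zero, iteratedFDeriv_zero_apply,
    iteratedFDeriv_one_apply, iteratedFDeriv_two_apply, map_add, map_sub,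
    add_apply, sub_apply] at hp hm
  have hc : |iteratedFDeriv ℝ 3 U z (fun _ => a + b) + iteratedFDeriv ℝ 3 U z (fun _ => a - b)| ≤
      6 * (C₀ * V z ^ ρ * ((α + β) ^ 2 * α)) := by
    refine (abs_apply_add_add_apply_sub_le _ a b).trans ?_
    calc _ ≤ 6 * (C₀ * V z ^ (ρ - (3 : ℕ) * δ)) *
          ((α * V z ^ δ + β * V z ^ δ) ^ 2 * (α * V z ^ δ)) := by
          gcongr; exact hD 3 (by norm_num) z hz
      _ = 6 * (C₀ * (V z ^ (ρ - (3 : ℕ) * δ) * (V z ^ δ) ^ 3) * ((α + β) ^ 2 * α)) := by ring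
      _ = _ := by rw [hscale 3]
  have hq2 : |fderiv ℝ (fderiv ℝ U) z a a| ≤ C₀ * V z ^ ρ * α ^ 2 := by
    have h1 := (iteratedFDeriv ℝ 2 U z).le_opNorm (fun _ => a)
    rw [iteratedFDeriv_two_apply, Finset.prod_const, Finset.card_univ, Fintype.card_fin,
      Real.norm_eq_abs] at h1
    refine h1.trans ?_
    calc _ ≤ (C₀ * V z ^ (ρ - (2 : ℕ) * δ)) * (α * V z ^ δ) ^ 2 := by
          gcongr; exact hD 2 (by norm_num) z hz
      _ = C₀ * (V z ^ (ρ - (2 : ℕ) * δ) * (V z ^ δ) ^ 2) * α ^ 2 := by ring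
      _ = _ := by rw [hscale 2]
  have hc' := (abs_le.1 hc).2
  have hq2' := (abs_le.1 hq2).2
  norm_num [Nat.factorial] at hp hm
  have hextra : 0 ≤ C₁ * V z ^ ρ * (α ^ 2 + (α + β) ^ 2 * α) +
      C₀ * V z ^ ρ * ((α + β) ^ 4 + (α + β) ^ q) := by positivity
  have h9 : 0 ≤ C₀ * V z ^ ρ * ((α + β) ^ 2 * α) := by positivity
  have h10 : 0 ≤ C₀ * V z ^ ρ * α ^ 2 := by positivity
  simp only [hUz] at hp hm
  have hfold : ∀ x, U x = V x ^ ρ := fun _ => rfl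
  linarith

end VTruncEM

/-! ### Gaussian moments and the coordinate-free generator -/

namespace VTruncEM

variable {d m : ℕ}

theorem stdGaussian_map_neg : (stdGaussian (E m)).map (fun x => -x) = stdGaussian (E m) :=
  stdGaussian_map (LinearIsometryEquiv.neg ℝ)

theorem integrable_one_add_norm_pow (q : ℕ) :
    Integrable (fun x : E m => (1 + ‖x‖) ^ q) (stdGaussian (E m)) := by
  rcases eq_or_ne q 0 with rfl | hq
  · simp only [pow_zero]
    exact integrable_const 1
  have h0 : MemLp (fun x : E m => ‖x‖) q (stdGaussian (E m)) :=
    (IsGaussian.memLp_id (stdGaussian (E m)) q (ENNReal.natCast_ne_top q)).norm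
  have h1 : MemLp (fun x : E m => 1 + ‖x‖) q (stdGaussian (E m)) :=
    (memLp_const (1 : ℝ)).add h0
  have h2 := h1.integrable_norm_pow hq
  have h3 (x : E m) : ‖1 + ‖x‖‖ = 1 + ‖x‖ := Real.norm_of_nonneg (by positivity)
  simpa only [h3] using h2

theorem integral_apply_mul_apply_stdGaussian (i j : Fin m) :
    ∫ x : E m, x i * x j ∂(stdGaussian (E m)) = if i = j then 1 else 0 := by
  have h := covarianceBilin_apply (μ := stdGaussian (E m)) IsGaussian.memLp_two_id
    (EuclideanSpace.single i 1) (EuclideanSpace.single j 1)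
  rw [covarianceBilin_stdGaussian] at h
  simp only [id_eq, integral_id_stdGaussian, sub_zero, EuclideanSpace.inner_single_left,
    map_one, one_mul] at h
  rw [← h]
  refine (innerSL_apply_apply ℝ (EuclideanSpace.single i (1 : ℝ))
    (EuclideanSpace.single j (1 : ℝ))).trans ?_
  rw [EuclideanSpace.inner_single_left]
  simp

theorem integrable_apply_mul_apply_stdGaussian (i j : Fin m) :
    Integrable (fun x : E m => x i * x j) (stdGaussian (E m)) := by
  have h (i : Fin m) : MemLp (fun x : E m => x i) 2 (stdGaussian (E m)) :=
    IsGaussian.memLp_dual _ (EuclideanSpace.proj i) 2 (by simp)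
  exact (h i).integrable_mul (h j)

theorem bilin_apply_eq_sum {F : Type*} [NormedAddCommGroup F] [NormedSpace ℝ F]
    (B : F →L[ℝ] F →L[ℝ] ℝ) (A : E m →L[ℝ] F) (x : E m) :
    B (A x) (A x) = ∑ i, ∑ j, x i * x j *
      B (A (EuclideanSpace.single i 1)) (A (EuclideanSpace.single j 1)) := by
  have hx : x = ∑ i, x i • EuclideanSpace.single i (1 : ℝ) := by
    simpa using ((EuclideanSpace.basisFun (Fin m) ℝ).sum_repr x).symm
  conv_lhs => rw [hx]
  simp only [map_sum, map_smul, sum_apply, smul_apply, smul_eq_mul, Finset.mul_sum, mul_assoc]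
  rw [Finset.sum_comm]
  exact Finset.sum_congr rfl fun _ _ => Finset.sum_congr rfl fun _ _ => by ring

theorem integrable_bilin_stdGaussian {F : Type*} [NormedAddCommGroup F] [NormedSpace ℝ F]
    (B : F →L[ℝ] F →L[ℝ] ℝ) (A : E m →L[ℝ] F) :
    Integrable (fun x => B (A x) (A x)) (stdGaussian (E m)) := by
  simp_rw [bilin_apply_eq_sum B A]
  exact integrable_finsetSum _ fun i _ => integrable_finsetSum _ fun j _ =>
    (integrable_apply_mul_apply_stdGaussian i j).mul_const _

theorem integral_bilin_stdGaussian {F : Type*} [NormedAddCommGroup F] [NormedSpace ℝ F]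
    (B : F →L[ℝ] F →L[ℝ] ℝ) (A : E m →L[ℝ] F) :
    ∫ x, B (A x) (A x) ∂(stdGaussian (E m)) =
      ∑ i, B (A (EuclideanSpace.single i 1)) (A (EuclideanSpace.single i 1)) := by
  simp_rw [bilin_apply_eq_sum B A]
  rw [integral_finsetSum _ fun i _ => integrable_finsetSum _ fun j _ =>
    (integrable_apply_mul_apply_stdGaussian i j).mul_const _]
  refine Finset.sum_congr rfl fun i _ => ?_
  rw [integral_finsetSum _ fun j _ => (integrable_apply_mul_apply_stdGaussian i j).mul_const _]
  simp_rw [integral_mul_const, integral_apply_mul_apply_stdGaussian]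
  simp

/-- The action of a matrix on Euclidean vectors. -/
noncomputable def matCLM (A : Matrix (Fin d) (Fin m) ℝ) : E m →L[ℝ] E d :=
  LinearMap.toContinuousLinearMap (Matrix.toLpLin 2 2 A)

theorem matCLM_apply (A : Matrix (Fin d) (Fin m) ℝ) (x : E m) :
    matCLM A x = WithLp.toLp 2 (A.mulVec x.ofLp) := rfl

theorem traceNorm_sq (A : Matrix (Fin d) (Fin m) ℝ) :
    traceNorm A ^ 2 = ∑ i, ∑ j, A i j ^ 2 := by
  have h : (A.transpose * A).trace = ∑ i, ∑ j, A i j ^ 2 := by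
    simp only [Matrix.trace, Matrix.diag, Matrix.mul_apply, Matrix.transpose_apply, ← sq]
    exact Finset.sum_comm
  rw [traceNorm, h, Real.sq_sqrt (by positivity)]

theorem norm_matCLM_apply_le (A : Matrix (Fin d) (Fin m) ℝ) (x : E m) :
    ‖matCLM A x‖ ≤ traceNorm A * ‖x‖ := by
  have h0 : 0 ≤ traceNorm A := Real.sqrt_nonneg _
  refine abs_le_of_sq_le_sq' ?_ (mul_nonneg h0 (norm_nonneg _)) |>.2
  rw [mul_pow, traceNorm_sq, EuclideanSpace.real_norm_sq_eq, EuclideanSpace.real_norm_sq_eq,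
    Finset.sum_mul]
  refine Finset.sum_le_sum fun i _ => ?_
  simp only [matCLM_apply, Matrix.mulVec, dotProduct]
  exact Finset.sum_mul_sq_le_sq_mul_sq _ _ _

/-- No differentiability of `U` is required, so the formula is also available at the origin, where
it gives `0` once `f` and `g` vanish. -/
theorem generator_eq (f : E d → E d) (g : E d → Matrix (Fin d) (Fin m) ℝ) (U : E d → ℝ)
    (x : E d) : generator f g U x = fderiv ℝ U x (f x) + 1 / 2 * ∑ j,
      fderiv ℝ (fderiv ℝ U) x (matCLM (g x) (EuclideanSpace.single j 1))
        (matCLM (g x) (EuclideanSpace.single j 1)) := by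
  have hexp (y : E d) : y = ∑ i, y i • EuclideanSpace.single i (1 : ℝ) := by
    simpa using ((EuclideanSpace.basisFun (Fin d) ℝ).sum_repr y).symm
  have h1 : ∑ i, partialDeriv 1 U x ![i] * f x i = fderiv ℝ U x (f x) := by
    conv_rhs => rw [hexp (f x)]
    simp only [map_sum, map_smul, partialDeriv, iteratedFDeriv_one_apply, smul_eq_mul,
      Matrix.cons_val_zero]
    exact Finset.sum_congr rfl fun _ _ => mul_comm _ _
  have h2 : ((g x).transpose * hessian U x * g x).trace = ∑ j,
      fderiv ℝ (fderiv ℝ U) x (matCLM (g x) (EuclideanSpace.single j 1))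
        (matCLM (g x) (EuclideanSpace.single j 1)) := by
    refine Finset.sum_congr rfl fun j _ => ?_
    have hcol (i : Fin d) : matCLM (g x) (EuclideanSpace.single j 1) i = g x i j := by
      simp [matCLM_apply]
    have hb := bilin_apply_eq_sum (fderiv ℝ (fderiv ℝ U) x) (ContinuousLinearMap.id ℝ (E d))
      (matCLM (g x) (EuclideanSpace.single j 1))
    simp only [ContinuousLinearMap.id_apply, hcol] at hb
    rw [hb, Matrix.diag_apply, Matrix.mul_apply, Finset.sum_comm]
    simp only [Matrix.mul_apply, Matrix.transpose_apply, Finset.sum_mul, hessian, Matrix.of_apply,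
      partialDeriv, iteratedFDeriv_two_apply, Matrix.cons_val_zero, Matrix.cons_val_one]
    exact Finset.sum_congr rfl fun _ _ => Finset.sum_congr rfl fun _ _ => by ring
  rw [generator, h1, h2]

end VTruncEM

/-! ### The one-step Lyapunov inequality -/

namespace VTruncEM

variable {d m : ℕ}

theorem apply_trunc_le {V : E d → ℝ}
    (hVε : ∀ (x : E d) (ε : ℝ), 0 < ε → ε ≤ 1 → V (ε • x) ≤ V x) {R : ℝ} (hR : 0 < R) (x : E d) :
    V (trunc R x) ≤ V x := by
  rcases eq_or_ne x 0 with rfl | hx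
  · simp [trunc]
  have hx0 : 0 < ‖x‖ := norm_pos_iff.2 hx
  exact hVε x _ (div_pos (lt_min hx0 hR) hx0) (div_le_one_of_le₀ (min_le_left _ _) hx0.le)

theorem norm_trunc_le {R : ℝ} (hR : 0 < R) (x : E d) : ‖trunc R x‖ ≤ R := by
  rcases eq_or_ne x 0 with rfl | hx
  · simpa [trunc] using hR.le
  have hx0 : 0 < ‖x‖ := norm_pos_iff.2 hx
  rw [trunc, norm_smul, Real.norm_of_nonneg (by positivity), div_mul_cancel₀ _ hx0.ne']
  exact min_le_right _ _

theorem Lam_nonneg {V w : E d → ℝ} (hV : ∀ x, 0 ≤ V x) (hw : ∀ x, 0 ≤ w x) (ρ : ℝ) (x : E d) :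
    0 ≤ Lam V w ρ x :=
  le_min zero_le_one (div_nonneg (hw x) (Real.rpow_nonneg (hV x) _))

/-- Here `s² = hΔ`, `ℓ² = Λ` and `ζ` is the norm of the Gaussian. The point is that each error term
retains both `s^4` and `ℓ²`: the first makes it `o(Δ)`, the second lets `w` absorb it. -/
theorem error_terms_le {s ℓ ζ : ℝ} (hs0 : 0 ≤ s) (hs1 : s ≤ 1) (hℓ0 : 0 ≤ ℓ) (hℓ1 : ℓ ≤ 1)
    (hζ : 0 ≤ ζ) {q : ℕ} (hq : 4 ≤ q) :
    (s ^ 2 * ℓ) ^ 2 + (s ^ 2 * ℓ + s * ℓ * ζ) ^ 2 * (s ^ 2 * ℓ) + (s ^ 2 * ℓ + s * ℓ * ζ) ^ 4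
      + (s ^ 2 * ℓ + s * ℓ * ζ) ^ q ≤ 4 * (s ^ 4 * ℓ ^ 2 * (1 + ζ) ^ q) := by
  have hsum : s ^ 2 * ℓ + s * ℓ * ζ ≤ s * ℓ * (1 + ζ) := by
    have : s * ℓ * s ≤ s * ℓ * 1 := by gcongr
    linarith
  have h0 : 0 ≤ s ^ 2 * ℓ + s * ℓ * ζ := by positivity
  have h1ζ : 1 ≤ 1 + ζ := by linarith
  have hk : ∀ k, k ≤ q → (1 + ζ) ^ k ≤ (1 + ζ) ^ q := fun k hk => pow_le_pow_right₀ h1ζ hk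
  have hpow : ∀ k, 4 ≤ k → k ≤ q →
      (s ^ 2 * ℓ + s * ℓ * ζ) ^ k ≤ s ^ 4 * ℓ ^ 2 * (1 + ζ) ^ q := by
    intro k h4 hkq
    calc _ ≤ (s * ℓ * (1 + ζ)) ^ k := by gcongr
      _ = s ^ k * ℓ ^ k * (1 + ζ) ^ k := by rw [mul_pow, mul_pow]
      _ ≤ s ^ 4 * ℓ ^ 2 * (1 + ζ) ^ q := by
          have := pow_le_pow_of_le_one hs0 hs1 h4
          have := pow_le_pow_of_le_one hℓ0 hℓ1 (show 2 ≤ k by omega)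
          have := hk k hkq
          gcongr
  have e1 : (s ^ 2 * ℓ) ^ 2 ≤ s ^ 4 * ℓ ^ 2 * (1 + ζ) ^ q := by
    calc _ = s ^ 4 * ℓ ^ 2 * 1 := by ring
      _ ≤ _ := by gcongr; exact one_le_pow₀ h1ζ
  have e2 : (s ^ 2 * ℓ + s * ℓ * ζ) ^ 2 * (s ^ 2 * ℓ) ≤ s ^ 4 * ℓ ^ 2 * (1 + ζ) ^ q := by
    calc _ ≤ (s * ℓ * (1 + ζ)) ^ 2 * (s ^ 2 * 1) := by gcongr
      _ = s ^ 4 * ℓ ^ 2 * (1 + ζ) ^ 2 := by ring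
      _ ≤ _ := by gcongr 1; exact hk 2 (by omega)
  linarith [hpow 4 le_rfl hq, hpow q hq le_rfl]

/-- The generator supplies `-Δ w(z)`, and half of it pays for the Taylor error. The constant is
chosen before `f`, `g` and `w`; lower integrals avoid any integrability question for `V^ρ` after the
step. -/
theorem LyapunovBar.exists_lintegral_step_le {δ : ℝ} {V : E d → ℝ} (hV : LyapunovBar 4 δ V)
    (hδ0 : 0 < δ) (hδ1 : δ ≤ 1) {ρ : ℝ} (hρ : 0 < ρ) (m : ℕ) : ∃ C : ℝ, 0 < C ∧
    ∀ (f : E d → E d) (g : E d → Matrix (Fin d) (Fin m) ℝ) (w : E d → ℝ), (∀ x, 0 ≤ w x) →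
    (∀ x, generator f g (fun y => V y ^ ρ) x ≤ - w x) →
    ∀ (z : E d) (Δ h : ℝ), z ≠ 0 → 0 < Δ → 0 ≤ h → h * Δ ≤ 1 → C * (h * Δ) ^ 2 ≤ Δ →
    ‖f z‖ ≤ h * (Lam V w ρ z ^ (1 / 2 : ℝ) * V z ^ δ) →
    traceNorm (g z) ^ 2 ≤ h * (Lam V w ρ z * V z ^ (2 * δ)) →
    ∫⁻ x, ENNReal.ofReal (V (z + (Δ • f z + matCLM (g z) (√Δ • x))) ^ ρ) ∂(stdGaussian (E m))
      + ENNReal.ofReal (Δ / 2 * w z) ≤ ENNReal.ofReal (V z ^ ρ) := by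
  obtain ⟨C, q, hC, hq, hsymm⟩ := hV.exists_rpow_symm_le hδ0 hδ1 hρ
  set M : ℝ := ∫ x : E m, (1 + ‖x‖) ^ q ∂(stdGaussian (E m)) with hM
  have hM0 : 0 ≤ M := integral_nonneg fun x => by positivity
  -- The error integrates to `4 C M w(z) (hΔ)²`, which must not exceed `Δ w(z) / 2`; the `1` only
  -- ensures positivity.
  refine ⟨8 * C * M + 1, by positivity, ?_⟩
  intro f g w hw hLV z Δ h hz hΔ hh hhΔ hsmall hf hg
  have hv : 0 < V z := hV.pos hz
  have hvρ : 0 < V z ^ ρ := Real.rpow_pos_of_pos hv ρ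
  have hΛ0 : 0 ≤ Lam V w ρ z := Lam_nonneg hV.nonneg hw ρ z
  set U : E d → ℝ := fun y => V y ^ ρ with hU
  set ℓ : ℝ := √(Lam V w ρ z) with hℓ
  have hℓsq : ℓ ^ 2 = Lam V w ρ z := Real.sq_sqrt hΛ0
  have hℓ0 : 0 ≤ ℓ := Real.sqrt_nonneg _
  have hℓ1 : ℓ ≤ 1 := Real.sqrt_le_one.2 (min_le_left _ _)
  -- This converts an error proportional to `V^ρ Λ` into one proportional to `w`.
  have hΛw : V z ^ ρ * ℓ ^ 2 ≤ w z := by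
    rw [hℓsq]
    calc _ ≤ V z ^ ρ * (w z / V z ^ ρ) := by gcongr; exact min_le_right _ _
      _ = w z := by field_simp
  set s : ℝ := √(h * Δ) with hs
  have hs0 : 0 ≤ s := Real.sqrt_nonneg _
  have hssq : s ^ 2 = h * Δ := Real.sq_sqrt (by positivity)
  have hs1 : s ≤ 1 := Real.sqrt_le_one.2 hhΔ
  set A : E m →L[ℝ] E d := √Δ • matCLM (g z) with hA
  have hAx (x : E m) : matCLM (g z) (√Δ • x) = A x := by simp [hA]
  have hα : ‖Δ • f z‖ ≤ (s ^ 2 * ℓ) * V z ^ δ := by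
    rw [norm_smul, Real.norm_of_nonneg hΔ.le, hssq]
    rw [← Real.sqrt_eq_rpow] at hf
    calc _ ≤ Δ * (h * (ℓ * V z ^ δ)) := by gcongr
      _ = _ := by ring
  have hβ (x : E m) : ‖A x‖ ≤ (s * ℓ * ‖x‖) * V z ^ δ := by
    have hvδ : 0 < V z ^ δ := Real.rpow_pos_of_pos hv δ
    have hg' : traceNorm (g z) ≤ √h * ℓ * V z ^ δ := by
      refine (abs_le_of_sq_le_sq' ?_ (by positivity)).2
      rw [mul_pow, mul_pow, hℓsq, Real.sq_sqrt hh, ← Real.rpow_natCast (V z ^ δ),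
        ← Real.rpow_mul hv.le, mul_comm δ, Nat.cast_ofNat]
      linarith
    rw [hA, smul_apply, norm_smul, Real.norm_of_nonneg (Real.sqrt_nonneg _)]
    calc _ ≤ √Δ * ((√h * ℓ * V z ^ δ) * ‖x‖) := by
          gcongr
          exact (norm_matCLM_apply_le _ _).trans (by gcongr)
      _ = _ := by rw [hs, Real.sqrt_mul hh]; ring
  set D₁ : ℝ := fderiv ℝ U z (Δ • f z) with hD₁
  set B := fderiv ℝ (fderiv ℝ U) z with hB
  set H : E m → ℝ := fun x => V z ^ ρ + D₁ + 1 / 2 * B (A x) (A x)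
    + 4 * C * w z * s ^ 4 * (1 + ‖x‖) ^ q with hH
  set Φ : E m → ℝ := fun x => V (z + (Δ • f z + A x)) ^ ρ with hΦ
  have hΦ0 (x : E m) : 0 ≤ Φ x := Real.rpow_nonneg (hV.nonneg _) _
  have hΦH (x : E m) : (Φ x + Φ (-x)) / 2 ≤ H x := by
    have h1 := hsymm z hz (Δ • f z) (A x) _ _ hα (hβ x)
    rw [sub_eq_add_neg, ← map_neg] at h1
    refine h1.trans ?_
    have h2 := error_terms_le hs0 hs1 hℓ0 hℓ1 (norm_nonneg x) hq
    have h3 : C * V z ^ ρ * (4 * (s ^ 4 * ℓ ^ 2 * (1 + ‖x‖) ^ q)) ≤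
        4 * C * w z * s ^ 4 * (1 + ‖x‖) ^ q := by
      calc _ = 4 * C * (V z ^ ρ * ℓ ^ 2) * s ^ 4 * (1 + ‖x‖) ^ q := by ring
        _ ≤ _ := by gcongr
    have h4 := mul_le_mul_of_nonneg_left h2 (by positivity : 0 ≤ C * V z ^ ρ)
    simp only [hH]
    linarith
  have hH0 (x : E m) : 0 ≤ H x := le_trans (by linarith [hΦ0 x, hΦ0 (-x)]) (hΦH x)
  have hΦm : Measurable Φ := by
    have hVc : Continuous V := hV.contDiff.continuous
    have : Continuous Φ := (hVc.comp (by fun_prop)).rpow_const fun _ => Or.inr hρ.le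
    exact this.measurable
  have hi1 : Integrable (fun x => 1 / 2 * B (A x) (A x)) (stdGaussian (E m)) :=
    (integrable_bilin_stdGaussian B A).const_mul _
  have hi2 : Integrable (fun x : E m => 4 * C * w z * s ^ 4 * (1 + ‖x‖) ^ q)
      (stdGaussian (E m)) := (integrable_one_add_norm_pow q).const_mul _
  have hi3 : Integrable (fun x : E m => V z ^ ρ + D₁ + 1 / 2 * B (A x) (A x))
      (stdGaussian (E m)) := (integrable_const _).add hi1
  have hHi : Integrable H (stdGaussian (E m)) := hi3.add hi2
  have hint : ∫ x, H x ∂(stdGaussian (E m)) ≤ V z ^ ρ - Δ / 2 * w z := by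
    have e1 : ∫ x, H x ∂(stdGaussian (E m)) = V z ^ ρ + Δ * generator f g U z
        + 4 * C * w z * s ^ 4 * M := by
      simp only [hH]
      rw [integral_add hi3 hi2, integral_add (integrable_const _) hi1,
        integral_const_mul, integral_const_mul, integral_bilin_stdGaussian, generator_eq]
      have e2 : ∑ i, B (A (EuclideanSpace.single i 1)) (A (EuclideanSpace.single i 1)) =
          Δ * ∑ i, B (matCLM (g z) (EuclideanSpace.single i 1))
            (matCLM (g z) (EuclideanSpace.single i 1)) := by
        rw [Finset.mul_sum]
        refine Finset.sum_congr rfl fun i _ => ?_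
        simp only [hA, smul_apply, map_smul, smul_eq_mul]
        rw [← mul_assoc, Real.mul_self_sqrt hΔ.le]
      rw [e2, hD₁, map_smul, smul_eq_mul]
      simp only [integral_const, probReal_univ, one_smul]
      ring
    rw [e1]
    have h1 : Δ * generator f g U z ≤ Δ * (- w z) := by gcongr; exact hLV z
    have h2 : s ^ 4 = (h * Δ) ^ 2 := by rw [← hssq]; ring
    have h3 : 4 * C * w z * s ^ 4 * M ≤ Δ / 2 * w z := by
      have h5 : 8 * C * M * (h * Δ) ^ 2 ≤ Δ := by
        refine le_trans ?_ hsmall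
        gcongr
        linarith
      rw [h2]
      calc _ = w z / 2 * (8 * C * M * (h * Δ) ^ 2) := by ring
        _ ≤ w z / 2 * Δ := by
            have := hw z
            gcongr
        _ = _ := by ring
    linarith
  -- Symmetry of the Gaussian law replaces the integral of `Φ` by that of its even part, which is
  -- bounded by the integrable `H`.
  have hneg : ∫⁻ x, ENNReal.ofReal (Φ (-x)) ∂(stdGaussian (E m)) =
      ∫⁻ x, ENNReal.ofReal (Φ x) ∂(stdGaussian (E m)) := by
    conv_rhs => rw [← stdGaussian_map_neg]
    rw [lintegral_map (by fun_prop) (by fun_prop)]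
  have hΦle : ∫⁻ x, ENNReal.ofReal (Φ x) ∂(stdGaussian (E m)) ≤
      ENNReal.ofReal (∫ x, H x ∂(stdGaussian (E m))) := by
    have h2 : 2 * ∫⁻ x, ENNReal.ofReal (Φ x) ∂(stdGaussian (E m)) ≤
        2 * ENNReal.ofReal (∫ x, H x ∂(stdGaussian (E m))) := by
      rw [ofReal_integral_eq_lintegral_ofReal hHi (ae_of_all _ hH0), two_mul]
      nth_rewrite 2 [← hneg]
      rw [← lintegral_add_left (by fun_prop), ← lintegral_const_mul' _ _ (by simp)]
      refine lintegral_mono fun x => ?_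
      have h3 : 2 * ENNReal.ofReal (H x) = ENNReal.ofReal (2 * H x) := by
        rw [ENNReal.ofReal_mul zero_le_two, ENNReal.ofReal_ofNat]
      rw [← ENNReal.ofReal_add (hΦ0 _) (hΦ0 _), h3]
      exact ENNReal.ofReal_le_ofReal (by linarith [hΦH x])
    exact (ENNReal.mul_le_mul_iff_right (by simp) (by simp)).1 h2
  simp_rw [hAx]
  have hH_int : 0 ≤ ∫ x, H x ∂(stdGaussian (E m)) := integral_nonneg hH0
  calc _ ≤ ENNReal.ofReal (∫ x, H x ∂(stdGaussian (E m))) + ENNReal.ofReal (Δ / 2 * w z) := by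
        gcongr
    _ ≤ _ := by
        rw [← ENNReal.ofReal_add hH_int (mul_nonneg (by positivity) (hw z))]
        exact ENNReal.ofReal_le_ofReal (by linarith)

end VTruncEM

/-! ### Brownian increments and measurability of the scheme -/

namespace VTruncEM

variable {d m : ℕ} {Ω : Type*} [MeasurableSpace Ω] {P : Measure Ω} {B : ℝ≥0 → Ω → E m}

/-- The increment of `B` over the `k`-th cell of the grid of mesh `Δ`. -/
def increment (B : ℝ≥0 → Ω → E m) (Δ : ℝ≥0) (k : ℕ) (ω : Ω) : E m :=
  B (((k + 1 : ℕ) : ℝ≥0) * Δ) ω - B ((k : ℝ≥0) * Δ) ω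

theorem IsBrownianMotion.measurable_increment (hB : IsBrownianMotion B P) (Δ : ℝ≥0) (k : ℕ) :
    Measurable (increment B Δ k) :=
  (hB.measurable _).sub (hB.measurable _)

/-- Independence across coordinates combines with independent increments within each coordinate to
give joint independence over the product index. -/
theorem IsBrownianMotion.iIndepFun_increment (hB : IsBrownianMotion B P) (Δ : ℝ≥0) :
    iIndepFun (fun (p : Fin m × ℕ) ω => increment B Δ p.2 ω p.1) P := by
  refine iIndepFun_uncurry' (X := fun (j : Fin m) (k : ℕ) ω => increment B Δ k ω j)
    (fun j k => ?_) ?_ fun j => ?_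
  · have := hB.measurable_increment Δ k
    fun_prop
  · exact hB.indep.comp
      (fun _ p (k : ℕ) => p (((k + 1 : ℕ) : ℝ≥0) * Δ) - p ((k : ℝ≥0) * Δ)) (fun _ => by fun_prop)
  · exact (hB.brownian j).toIsPreBrownianReal.hasIndepIncrements.nat
      (t := fun k : ℕ => (k : ℝ≥0) * Δ) (fun a b hab => by dsimp only; gcongr)

theorem IsBrownianMotion.map_increment (hB : IsBrownianMotion B P) {Δ : ℝ≥0} (hΔ : 0 < Δ)
    (k : ℕ) : P.map (fun ω => (√(Δ : ℝ))⁻¹ • increment B Δ k ω) = stdGaussian (E m) := by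
  have hlaw (j : Fin m) : HasLaw (fun ω => (√(Δ : ℝ))⁻¹ * increment B Δ k ω j)
      (gaussianReal 0 1) P := by
    have h := gaussianReal_const_mul ((hB.brownian j).toIsPreBrownianReal.hasLaw_sub
      (((k + 1 : ℕ) : ℝ≥0) * Δ) ((k : ℝ≥0) * Δ)) (√(Δ : ℝ))⁻¹
    have hv : NNReal.mk ((√(Δ : ℝ))⁻¹ ^ 2) (sq_nonneg _) *
        nndist ((((k + 1 : ℕ) : ℝ≥0) * Δ : ℝ≥0) : ℝ) (((k : ℝ≥0) * Δ : ℝ≥0) : ℝ) = 1 := by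
      apply NNReal.eq
      have hd : dist (((k : ℝ) + 1) * Δ) (k * Δ) = Δ := by
        rw [Real.dist_eq, add_mul, add_sub_cancel_left, one_mul, NNReal.abs_eq]
      have hΔ' : (Δ : ℝ) ≠ 0 := by exact_mod_cast hΔ.ne'
      simp [hd, hΔ']
    rw [mul_zero] at h
    exact hv ▸ h
  have hind : iIndepFun (fun (j : Fin m) ω => (√(Δ : ℝ))⁻¹ * increment B Δ k ω j) P :=
    ((hB.iIndepFun_increment Δ).precomp (g := fun j : Fin m => (j, k))
      (fun a b h => (Prod.mk.inj h).1)).comp (fun _ x => (√(Δ : ℝ))⁻¹ * x) (fun _ => by fun_prop)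
  have hpi := (hind.hasLaw_pi hlaw).map_eq
  have hm (j : Fin m) : Measurable fun ω => increment B Δ k ω j := by
    have := hB.measurable_increment Δ k
    fun_prop
  have hm' : Measurable fun ω (j : Fin m) => (√(Δ : ℝ))⁻¹ * increment B Δ k ω j :=
    measurable_pi_lambda _ fun j => (hm j).const_mul _
  rw [← map_pi_eq_stdGaussian, ← hpi, Measure.map_map (WithLp.measurable_toLp 2 _) hm']
  rfl

/-- By induction `Z n` is measurable with respect to the increments over cells before `n`; these are
indexed by a finite set disjoint from that of cell `n`. -/
theorem IsBrownianMotion.indepFun_increment [IsProbabilityMeasure P] (hB : IsBrownianMotion B P)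
    (Δ : ℝ≥0) {Z : ℕ → Ω → E d} {x₀ : E d} (hZ0 : Z 0 = fun _ => x₀) {Ψ : E d × E m → E d}
    (hΨ : Measurable Ψ) (hZ : ∀ k ω, Z (k + 1) ω = Ψ (Z k ω, increment B Δ k ω)) (n : ℕ) :
    IndepFun (Z n) (increment B Δ n) P := by
  let X : Fin m × ℕ → Ω → ℝ := fun p ω => increment B Δ p.2 ω p.1
  have hXm : ∀ p, Measurable (X p) := fun p => by
    have := hB.measurable_increment Δ p.2
    fun_prop
  let S : Finset (Fin m × ℕ) := Finset.univ ×ˢ Finset.range n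
  let T : Finset (Fin m × ℕ) := Finset.univ ×ˢ {n}
  have hST : Disjoint S T := by
    rw [Finset.disjoint_left]
    rintro ⟨j, k⟩ h1 h2
    simp only [S, T, Finset.mem_product, Finset.mem_range, Finset.mem_singleton] at h1 h2
    omega
  have hind := (hB.iIndepFun_increment Δ).indepFun_finset S T hST hXm
  have hinc : ∀ (I : Finset (Fin m × ℕ)) (k : ℕ), (∀ j, (j, k) ∈ I) →
      Measurable[MeasurableSpace.comap (fun ω (i : I) => X i ω) inferInstance]
        (increment B Δ k) := by
    intro I k hk
    let F : (I → ℝ) → E m := fun y => WithLp.toLp 2 fun j => y ⟨(j, k), hk j⟩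
    have hF : Measurable F := by fun_prop
    exact hF.comp (comap_measurable _)
  have hZm : ∀ k ≤ n, Measurable[MeasurableSpace.comap (fun ω (i : S) => X i ω) inferInstance]
      (Z k) := by
    intro k
    induction k with
    | zero => intro _; rw [hZ0]; exact measurable_const
    | succ k ih =>
      intro hk
      have h1 := ih (by omega)
      have h2 := hinc S k (fun j => by simp [S]; omega)
      have : Z (k + 1) = fun ω => Ψ (Z k ω, increment B Δ k ω) := funext (hZ k)
      rw [this]
      exact hΨ.comp (h1.prodMk h2)
  rw [IndepFun_iff_Indep] at hind ⊢
  exact indep_of_indep_of_le_right (indep_of_indep_of_le_left hind (hZm n le_rfl).comap_le)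
    (hinc T n (fun j => by simp [T])).comap_le

theorem LocallyLipschitzCoeffs.continuous_of_dist_le {f : E d → E d}
    {g : E d → Matrix (Fin d) (Fin m) ℝ} (h : LocallyLipschitzCoeffs f g) {F : Type*}
    [NormedAddCommGroup F] {φ : E d → F}
    (hφ : ∀ x y, ‖φ x - φ y‖ ≤ max ‖f x - f y‖ (traceNorm (g x - g y))) : Continuous φ := by
  rw [continuous_iff_continuousAt]
  intro x
  obtain ⟨C, hC, hL⟩ := h (‖x‖ + 1) (by positivity)
  rw [ContinuousAt, tendsto_iff_norm_sub_tendsto_zero]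
  have h1 : Tendsto (fun y => C * ‖y - x‖) (𝓝 x) (𝓝 0) := by
    have : Continuous fun y : E d => C * ‖y - x‖ := by fun_prop
    simpa using this.tendsto x
  refine squeeze_zero' (Eventually.of_forall fun _ => norm_nonneg _) ?_ h1
  filter_upwards [Metric.ball_mem_nhds x one_pos] with y hy
  refine (hφ y x).trans (hL y x (max_le ?_ (by linarith)))
  have h2 : ‖y - x‖ < 1 := by rwa [← dist_eq_norm]
  have h3 := norm_le_norm_add_norm_sub' y x
  linarith

theorem LocallyLipschitzCoeffs.continuous_drift {f : E d → E d}
    {g : E d → Matrix (Fin d) (Fin m) ℝ} (h : LocallyLipschitzCoeffs f g) : Continuous f :=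
  h.continuous_of_dist_le fun _ _ => le_max_left _ _

theorem LocallyLipschitzCoeffs.continuous_diffusion {f : E d → E d}
    {g : E d → Matrix (Fin d) (Fin m) ℝ} (h : LocallyLipschitzCoeffs f g) (i : Fin d)
    (j : Fin m) : Continuous fun x => g x i j :=
  h.continuous_of_dist_le fun x y => le_max_of_le_right <| by
    have h0 : 0 ≤ traceNorm (g x - g y) := Real.sqrt_nonneg _
    refine abs_le_of_sq_le_sq ?_ h0
    rw [traceNorm_sq]
    calc (g x i j - g y i j) ^ 2 ≤ ∑ j, (g x - g y) i j ^ 2 :=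
          Finset.single_le_sum (f := fun j => (g x - g y) i j ^ 2) (fun _ _ => sq_nonneg _)
            (Finset.mem_univ j)
      _ ≤ _ := Finset.single_le_sum (f := fun i => ∑ j, (g x - g y) i j ^ 2)
            (fun _ _ => Finset.sum_nonneg fun _ _ => sq_nonneg _) (Finset.mem_univ i)

/-- One step of the truncated Euler–Maruyama scheme. -/
noncomputable def emStep (f : E d → E d) (g : E d → Matrix (Fin d) (Fin m) ℝ) (R Δ : ℝ)
    (p : E d × E m) : E d :=
  trunc R (p.1 + Δ • f p.1 + matCLM (g p.1) p.2)

theorem measurable_emStep {f : E d → E d} {g : E d → Matrix (Fin d) (Fin m) ℝ}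
    (h : LocallyLipschitzCoeffs f g) (R Δ : ℝ) : Measurable (emStep f g R Δ) := by
  have ht : Measurable (trunc R : E d → E d) := by
    unfold trunc
    fun_prop
  refine ht.comp (Continuous.measurable ?_)
  have h1 := h.continuous_drift
  have h2 : Continuous fun p : E d × E m => matCLM (g p.1) p.2 := by
    have hg := h.continuous_diffusion
    have : Continuous fun p : E d × E m => fun i => ∑ j, g p.1 i j * p.2 j := by
      refine continuous_pi fun i => continuous_finsetSum _ fun j _ => ?_
      exact ((hg i j).comp continuous_fst).mul (by fun_prop)
    exact (PiLp.continuous_toLp 2 _).comp this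
  fun_prop

end VTruncEM

/-! ### Truncation radius, choice of the step size, almost sure convergence -/

namespace VTruncEM

variable {d m : ℕ}

theorem TruncationFun.radius_spec {f : E d → E d} {g : E d → Matrix (Fin d) (Fin m) ℝ}
    {V w : E d → ℝ} {ρ δ : ℝ} {φ : ℝ → ℝ} (hφ : TruncationFun f g V w ρ δ φ) {K θ r : ℝ}
    {Δ : ℝ≥0} (hr : 0 < r) (h : φ r ≤ K * (Δ : ℝ) ^ (-θ)) :
    r ≤ radius φ K θ Δ ∧ φ (radius φ K θ Δ) = K * (Δ : ℝ) ^ (-θ) := by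
  set y := K * (Δ : ℝ) ^ (-θ) with hy
  have hex : ∃ a ∈ Set.Ioi (0 : ℝ), φ a = y := by
    obtain ⟨u, hu1, hu2⟩ := ((hφ.tendsto.eventually_ge_atTop y).and (eventually_ge_atTop r)).exists
    obtain ⟨a, ha, hay⟩ := intermediate_value_Icc hu2
      (hφ.cont.mono fun x hx => lt_of_lt_of_le hr hx.1) ⟨h, hu1⟩
    exact ⟨a, lt_of_lt_of_le hr ha.1, hay⟩
  have h1 : radius φ K θ Δ ∈ Set.Ioi (0 : ℝ) := Function.invFunOn_mem hex
  have h2 : φ (radius φ K θ Δ) = y := Function.invFunOn_eq hex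
  exact ⟨(hφ.strictMono.le_iff_le hr h1).1 (by rwa [h2]), h2⟩

/-- By compactness every subsequence has a further convergent one, and continuity of `w` places its
limit in the zero set. -/
theorem tendsto_infEDist_zero_set {z : ℕ → E d} {w : E d → ℝ} (hw : Continuous w) {R : ℝ}
    (hz : ∀ k, ‖z k‖ ≤ R) (hwz : Tendsto (fun k => w (z k)) atTop (𝓝 0)) :
    Tendsto (fun k => Metric.infEDist (z k) {x | w x = 0}) atTop (𝓝 0) := by
  refine tendsto_of_subseq_tendsto fun ns hns => ?_
  obtain ⟨a, -, ms, hms, hlim⟩ := (isCompact_closedBall (0 : E d) R).tendsto_subseq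
    (x := fun k => z (ns k)) (fun k => by simpa using hz (ns k))
  refine ⟨ms, ?_⟩
  have ha : w a = 0 := tendsto_nhds_unique ((hw.tendsto a).comp hlim)
    (hwz.comp (hns.comp hms.tendsto_atTop))
  have h := (Metric.continuous_infEDist (s := {x | w x = 0})).tendsto a |>.comp hlim
  rwa [Metric.infEDist_zero_of_mem (by exact ha)] at h

/-- The quantities to control are `K Δ^{1-θ}` and, after division by `Δ`, `C K² Δ^{1-2θ}`; both
exponents are positive because `θ < 1/2`. -/
theorem exists_step_bound {C K θ : ℝ} (hθ : θ < 1 / 2) {Δs : ℝ≥0} (hΔs : 0 < Δs) :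
    ∃ Δss : ℝ≥0, 0 < Δss ∧ Δss ≤ Δs ∧ ∀ Δ : ℝ≥0, 0 < Δ → Δ ≤ Δss →
      (K * (Δ : ℝ) ^ (-θ)) * Δ ≤ 1 ∧ C * ((K * (Δ : ℝ) ^ (-θ)) * Δ) ^ 2 ≤ Δ := by
  have h1 : Tendsto (fun x : ℝ => K * x ^ (1 - θ)) (𝓝 0) (𝓝 0) := by
    have := (Real.continuousAt_rpow_const (0 : ℝ) (1 - θ) (Or.inr (by linarith))).tendsto.const_mul K
    rwa [Real.zero_rpow (by linarith), mul_zero] at this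
  have h2 : Tendsto (fun x : ℝ => C * K ^ 2 * x ^ (1 - 2 * θ)) (𝓝 0) (𝓝 0) := by
    have := (Real.continuousAt_rpow_const (0 : ℝ) (1 - 2 * θ)
      (Or.inr (by linarith))).tendsto.const_mul (C * K ^ 2)
    rwa [Real.zero_rpow (by linarith), mul_zero] at this
  obtain ⟨ε, hε, h⟩ := Metric.eventually_nhds_iff.1
    ((h1.eventually_le_const one_pos).and (h2.eventually_le_const one_pos))
  refine ⟨min Δs (Real.toNNReal (ε / 2)), lt_min hΔs (Real.toNNReal_pos.2 (by linarith)),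
    min_le_left _ _, fun Δ hΔ hle => ?_⟩
  have hΔ' : (0 : ℝ) < Δ := hΔ
  have hΔε : (Δ : ℝ) < ε := by
    have h3 : (Δ : ℝ) ≤ (Real.toNNReal (ε / 2) : ℝ≥0) := by
      exact_mod_cast hle.trans (min_le_right _ _)
    rw [Real.coe_toNNReal _ (by linarith)] at h3
    linarith
  obtain ⟨h4, h5⟩ := @h (Δ : ℝ) (by rw [Real.dist_eq, sub_zero, abs_of_pos hΔ']; exact hΔε)
  have e1 : (Δ : ℝ) ^ (-θ) * Δ = (Δ : ℝ) ^ (1 - θ) := by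
    rw [sub_eq_neg_add, Real.rpow_add hΔ', Real.rpow_one]
  have e2 : ((Δ : ℝ) ^ (-θ) * Δ) ^ 2 = (Δ : ℝ) ^ (1 - 2 * θ) * Δ := by
    rw [e1, ← Real.rpow_natCast, ← Real.rpow_mul hΔ'.le]
    nth_rewrite 3 [← Real.rpow_one (Δ : ℝ)]
    rw [← Real.rpow_add hΔ']
    congr 1
    push_cast
    ring
  constructor
  · rw [mul_assoc, e1]; exact h4
  · calc C * ((K * (Δ : ℝ) ^ (-θ)) * Δ) ^ 2 = C * K ^ 2 * ((Δ : ℝ) ^ (-θ) * Δ) ^ 2 := by ring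
      _ = (C * K ^ 2 * (Δ : ℝ) ^ (1 - 2 * θ)) * Δ := by rw [e2]; ring
      _ ≤ 1 * Δ := by gcongr
      _ = Δ := one_mul _

/-- Telescoping makes `∑ b k` integrable, hence almost surely finite, and the terms of a convergent
series tend to zero. -/
theorem ae_tendsto_zero_of_lintegral_add_le {Ω : Type*} [MeasurableSpace Ω] {P : Measure Ω}
    {a b : ℕ → Ω → ℝ≥0∞} (hb : ∀ k, Measurable (b k)) (h0 : ∫⁻ ω, a 0 ω ∂P ≠ ∞)
    (h : ∀ k, ∫⁻ ω, a (k + 1) ω ∂P + ∫⁻ ω, b k ω ∂P ≤ ∫⁻ ω, a k ω ∂P) :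
    ∀ᵐ ω ∂P, Tendsto (fun k => b k ω) atTop (𝓝 0) := by
  have hsum : ∀ n, ∫⁻ ω, a n ω ∂P + ∑ k ∈ Finset.range n, ∫⁻ ω, b k ω ∂P ≤ ∫⁻ ω, a 0 ω ∂P := by
    intro n
    induction n with
    | zero => simp
    | succ n ih =>
      rw [Finset.sum_range_succ, add_comm (∑ k ∈ Finset.range n, _), ← add_assoc]
      exact (add_le_add_left (h n) _).trans ih
  have htsum : ∑' k, ∫⁻ ω, b k ω ∂P ≤ ∫⁻ ω, a 0 ω ∂P :=
    ENNReal.tsum_le_of_sum_range_le fun n => le_add_self.trans (hsum n)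
  rw [← lintegral_tsum fun k => (hb k).aemeasurable] at htsum
  filter_upwards [ae_lt_top (Measurable.tsum hb)
    (ne_top_of_le_ne_top h0 htsum)] with ω hω
  exact ENNReal.tendsto_atTop_zero_of_tsum_ne_top hω.ne

theorem scheme_succ_eq_emStep {Ω : Type*} (f : E d → E d) (g : E d → Matrix (Fin d) (Fin m) ℝ)
    (φ : ℝ → ℝ) (K θ : ℝ) (B : ℝ≥0 → Ω → E m) (x₀ : E d) (Δ : ℝ≥0) (k : ℕ) (ω : Ω) :
    scheme f g φ K θ B x₀ Δ (k + 1) ω =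
      emStep f g (radius φ K θ Δ) Δ (scheme f g φ K θ B x₀ Δ k ω, increment B Δ k ω) := rfl

/-- Independence of `Z k` and the normalised increment, via Fubini, turns the deterministic
inequality `hstep` into one for expectations. -/
theorem IsBrownianMotion.ae_tendsto_scheme {Ω : Type*} [MeasurableSpace Ω] {P : Measure Ω}
    [IsProbabilityMeasure P] {B : ℝ≥0 → Ω → E m} (hB : IsBrownianMotion B P) {f : E d → E d}
    {g : E d → Matrix (Fin d) (Fin m) ℝ} (hfg : LocallyLipschitzCoeffs f g) {U w : E d → ℝ}
    (hU : Measurable U) (hw : Continuous w) {φ : ℝ → ℝ} {K θ : ℝ} {x₀ : E d} {Δ : ℝ≥0}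
    (hΔ : 0 < Δ) (hR : 0 < radius φ K θ Δ) (hx₀ : ‖x₀‖ ≤ radius φ K θ Δ)
    (hstep : ∀ z : E d, ‖z‖ ≤ radius φ K θ Δ →
      ∫⁻ x, ENNReal.ofReal (U (emStep f g (radius φ K θ Δ) Δ (z, √(Δ : ℝ) • x)))
          ∂(stdGaussian (E m)) + ENNReal.ofReal (Δ / 2 * w z) ≤ ENNReal.ofReal (U z))
    (hw0 : ∀ x, 0 ≤ w x) :
    ∀ᵐ ω ∂P, Tendsto (fun k => w (scheme f g φ K θ B x₀ Δ k ω)) atTop (𝓝 0) := by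
  set R := radius φ K θ Δ with hRdef
  set Z := scheme f g φ K θ B x₀ Δ with hZdef
  have hΔ' : (0 : ℝ) < Δ := hΔ
  have hΨ := measurable_emStep hfg R Δ
  have hZ0 : Z 0 = fun _ => x₀ := rfl
  have hZs : ∀ k ω, Z (k + 1) ω = emStep f g R Δ (Z k ω, increment B Δ k ω) :=
    fun k ω => scheme_succ_eq_emStep f g φ K θ B x₀ Δ k ω
  clear_value Z R
  have hZR : ∀ k ω, ‖Z k ω‖ ≤ R := by
    rintro (_ | k) ω
    · rw [hZ0]; exact hx₀
    · rw [hZs]; exact norm_trunc_le hR _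
  have hZm : ∀ k, Measurable (Z k) := by
    intro k
    induction k with
    | zero => rw [hZ0]; exact measurable_const
    | succ k ih =>
      rw [funext (hZs k)]
      exact hΨ.comp (ih.prodMk (hB.measurable_increment Δ k))
  have hkey : ∀ k, ∫⁻ ω, ENNReal.ofReal (U (Z (k + 1) ω)) ∂P
      + ∫⁻ ω, ENNReal.ofReal (Δ / 2 * w (Z k ω)) ∂P ≤ ∫⁻ ω, ENNReal.ofReal (U (Z k ω)) ∂P := by
    intro k
    set η : Ω → E m := fun ω => (√(Δ : ℝ))⁻¹ • increment B Δ k ω with hη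
    have hηm : Measurable η :=
      (measurable_const_smul (√(Δ : ℝ))⁻¹).comp (hB.measurable_increment Δ k)
    have hind : IndepFun (Z k) η P :=
      (hB.indepFun_increment Δ hZ0 hΨ hZs k).comp
        measurable_id (measurable_const_smul (√(Δ : ℝ))⁻¹)
    have hjoint := (indepFun_iff_map_prod_eq_prod_map_map (hZm k).aemeasurable
      hηm.aemeasurable).1 hind
    rw [hη, hB.map_increment hΔ k] at hjoint
    let G : E d × E m → ℝ≥0∞ := fun p =>
      ENNReal.ofReal (U (emStep f g R Δ (p.1, √(Δ : ℝ) • p.2)))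
    have hG : Measurable G := by
      refine (hU.comp (hΨ.comp ?_)).ennreal_ofReal
      fun_prop
    have h1 : ∀ ω, ENNReal.ofReal (U (Z (k + 1) ω)) = G (Z k ω, η ω) := by
      intro ω
      have : √(Δ : ℝ) • η ω = increment B Δ k ω := by
        rw [hη, smul_smul, mul_inv_cancel₀ (Real.sqrt_pos.2 hΔ').ne', one_smul]
      simp only [G, this, hZs]
    have h2 : ∫⁻ ω, ENNReal.ofReal (U (Z (k + 1) ω)) ∂P =
        ∫⁻ ω, ∫⁻ x, G (Z k ω, x) ∂(stdGaussian (E m)) ∂P := by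
      simp_rw [h1]
      rw [← lintegral_map (f := G) hG ((hZm k).prodMk hηm), hjoint,
        lintegral_prod _ hG.aemeasurable, lintegral_map hG.lintegral_prod_right' (hZm k)]
    have h3 : Measurable fun ω => ∫⁻ x, G (Z k ω, x) ∂(stdGaussian (E m)) :=
      hG.lintegral_prod_right'.comp (hZm k)
    rw [h2, ← lintegral_add_left h3]
    exact lintegral_mono fun ω => hstep _ (hZR k ω)
  have hae := ae_tendsto_zero_of_lintegral_add_le (P := P)
    (a := fun k ω => ENNReal.ofReal (U (Z k ω)))
    (b := fun k ω => ENNReal.ofReal (Δ / 2 * w (Z k ω)))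
    (fun k => ((hw.measurable.comp (hZm k)).const_mul _).ennreal_ofReal)
    (by simp [hZ0]) hkey
  filter_upwards [hae] with ω hω
  have h3 := (ENNReal.tendsto_toReal ENNReal.zero_ne_top).comp hω
  have h4 : ∀ k, (ENNReal.ofReal (Δ / 2 * w (Z k ω))).toReal = Δ / 2 * w (Z k ω) := fun k =>
    ENNReal.toReal_ofReal (mul_nonneg (by positivity) (hw0 _))
  simp only [Function.comp_def, h4, ENNReal.toReal_zero] at h3
  have h5 := h3.const_mul (2 / (Δ : ℝ))
  rw [mul_zero] at h5
  refine h5.congr fun k => ?_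
  field_simp

end VTruncEM

/-! ### The convergence theorem -/

theorem theorem5p1 {d m : ℕ} {Ω : Type*} [MeasurableSpace Ω] (P : Measure Ω)
    [IsProbabilityMeasure P]
    -- the driving Brownian motion and the coefficients
    (B : ℝ≥0 → Ω → E m) (hB : IsBrownianMotion B P)
    (f : E d → E d) (g : E d → Matrix (Fin d) (Fin m) ℝ)
    (hfg : LocallyLipschitzCoeffs f g) (hf0 : f 0 = 0) (hg0 : g 0 = 0)
    -- the LaSalle-type condition
    (ρ : ℝ) (hρ : 0 < ρ) (V w : E d → ℝ)
    (hw : Continuous w) (hw0 : ∀ x, 0 ≤ w x)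
    (hLV : ∀ x, generator f g (fun y => V y ^ ρ) x ≤ - w x)
    -- the Lyapunov function and the growth condition
    (δ : ℝ) (hδ : ∃ N : ℕ, 4 ≤ N ∧ 1 / δ = N)
    (hV : LyapunovBar 4 δ V)
    (hVε : ∀ (x : E d) (ε : ℝ), 0 < ε → ε ≤ 1 → V (ε • x) ≤ V x)
    (hgrowth : GrowthCond f g V w ρ δ)
    -- the parameters of the scheme
    (x₀ : E d) (φ : ℝ → ℝ) (hφ : TruncationFun f g V w ρ δ φ)
    (θ : ℝ) (hθ0 : 0 < θ) (hθ1 : θ < 1 / 2)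
    (K : ℝ) (hK : 0 < K) (Δs : ℝ≥0) (hΔs0 : 0 < Δs) (hΔs1 : Δs < 1)
    (hKΔ : φ (max ‖x₀‖ 1) ≤ K * (Δs : ℝ) ^ (-θ)) :
    ∃ Δss : ℝ≥0, 0 < Δss ∧ Δss ≤ Δs ∧
      (∀ Δ : ℝ≥0, 0 < Δ → Δ ≤ Δss →
        ∀ᵐ ω ∂P,
          limsup (fun k => ((V (scheme f g φ K θ B x₀ Δ k ω) ^ ρ : ℝ) : EReal)) atTop < ⊤ ∧
          Tendsto (fun k => Metric.infEDist (scheme f g φ K θ B x₀ Δ k ω) {x | w x = 0})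
            atTop (𝓝 0)) ∧
      ((∀ x, w x = 0 ↔ x = 0) →
        ∀ Δ : ℝ≥0, 0 < Δ → Δ ≤ Δss →
          ∀ᵐ ω ∂P, Tendsto (fun k => scheme f g φ K θ B x₀ Δ k ω) atTop (𝓝 0)) := by
  obtain ⟨N, hN, hδN⟩ := hδ
  have hNpos : (0 : ℝ) < N := by exact_mod_cast (by omega : 0 < N)
  have hδ0 : 0 < δ := one_div_pos.1 (by rw [hδN]; exact hNpos)
  have hδ1 : δ ≤ 1 := by
    have h1 : (1 : ℝ) ≤ N := by exact_mod_cast (by omega : 1 ≤ N)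
    rw [← hδN, le_div_iff₀ hδ0] at h1
    linarith
  obtain ⟨C, hC, hstep⟩ := hV.exists_lintegral_step_le hδ0 hδ1 hρ m
  obtain ⟨Δss, hss0, hsss, hss⟩ := exists_step_bound (C := C) (K := K) hθ1 hΔs0
  -- The generator vanishes at the origin, so the Lyapunov condition there reads `0 ≤ -w(0)`.
  have hw00 : w 0 = 0 := by
    have h := hLV 0
    rw [generator_eq, hf0, hg0] at h
    have hA : ∀ x : E m, matCLM (0 : Matrix (Fin d) (Fin m) ℝ) x = 0 := fun x => by
      simp [matCLM_apply]
    simp only [hA, map_zero, Finset.sum_const_zero, mul_zero, add_zero] at h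
    exact le_antisymm (by linarith) (hw0 0)
  have hVc : Continuous V := hV.contDiff.continuous
  have hUc : Continuous fun x => V x ^ ρ := hVc.rpow_const fun _ => Or.inr hρ.le
  have hrad : ∀ Δ : ℝ≥0, 0 < Δ → Δ ≤ Δss →
      max ‖x₀‖ 1 ≤ radius φ K θ Δ ∧ φ (radius φ K θ Δ) = K * (Δ : ℝ) ^ (-θ) := by
    intro Δ hΔ hle
    refine hφ.radius_spec (lt_of_lt_of_le one_pos (le_max_right _ _)) (hKΔ.trans ?_)
    refine mul_le_mul_of_nonneg_left ?_ hK.le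
    exact Real.rpow_le_rpow_of_nonpos (by exact_mod_cast hΔ) (by exact_mod_cast hle.trans hsss)
      (by linarith)
  have hbdd : ∀ Δ : ℝ≥0, 0 < Δ → Δ ≤ Δss → ∀ k ω,
      ‖scheme f g φ K θ B x₀ Δ k ω‖ ≤ radius φ K θ Δ := by
    intro Δ hΔ hle k ω
    obtain ⟨h1, -⟩ := hrad Δ hΔ hle
    rcases k with _ | k
    · exact (le_max_left _ _).trans h1
    · exact norm_trunc_le (by linarith [le_max_right ‖x₀‖ 1]) _
  have hlim : ∀ Δ : ℝ≥0, 0 < Δ → Δ ≤ Δss → ∀ᵐ ω ∂P, Tendsto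
      (fun k => Metric.infEDist (scheme f g φ K θ B x₀ Δ k ω) {x | w x = 0}) atTop (𝓝 0) := by
    intro Δ hΔ hle
    have hΔ' : (0 : ℝ) < Δ := by exact_mod_cast hΔ
    obtain ⟨hR1, hφR⟩ := hrad Δ hΔ hle
    obtain ⟨hh1, hh2⟩ := hss Δ hΔ hle
    have h1R : 1 ≤ radius φ K θ Δ := (le_max_right _ _).trans hR1
    have hR : 0 < radius φ K θ Δ := by linarith
    have hae := hB.ae_tendsto_scheme hfg hUc.measurable hw hΔ hR ((le_max_left _ _).trans hR1)
      (fun z hz => ?_) hw0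
    · filter_upwards [hae] with ω hω
      exact tendsto_infEDist_zero_set hw (fun k => hbdd Δ hΔ hle k ω) hω
    -- The expansion excludes the origin, but the scheme is absorbed there and both sides are zero.
    rcases eq_or_ne z 0 with rfl | hz0
    · have h0 : ∀ x : E m, emStep f g (radius φ K θ Δ) Δ (0, x) = 0 := fun x => by
        simp [emStep, hf0, hg0, matCLM_apply, trunc]
      simp [h0, hw00, hV.map_zero, Real.zero_rpow hρ.ne']
    · have hzpos : 0 < ‖z‖ := norm_pos_iff.2 hz0
      have hf := hφ.bound_f _ h1R z hzpos hz
      have hg := hφ.bound_g _ h1R z hzpos hz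
      rw [hφR] at hf hg
      refine le_trans (add_le_add_left (lintegral_mono fun x => ?_) _)
        (hstep f g w hw0 hLV z Δ _ hz0 hΔ' (by positivity) hh1 hh2 hf hg)
      refine ENNReal.ofReal_le_ofReal (Real.rpow_le_rpow (hV.nonneg _) ?_ hρ.le)
      rw [← add_assoc]
      exact apply_trunc_le hVε hR _
  refine ⟨Δss, hss0, hsss, fun Δ hΔ hle => ?_, fun hker Δ hΔ hle => ?_⟩
  · filter_upwards [hlim Δ hΔ hle] with ω hω
    refine ⟨?_, hω⟩
    -- For fixed `Δ` the limsup is bounded by the maximum of `V^ρ` over the truncation ball.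
    obtain ⟨M, hM⟩ := (isCompact_closedBall (0 : E d) (radius φ K θ Δ)).bddAbove_image
      hUc.continuousOn
    refine lt_of_le_of_lt (limsup_le_of_le (a := ((M : ℝ) : EReal)) ?_ ?_) (EReal.coe_lt_top M)
    · isBoundedDefault
    · refine Eventually.of_forall fun k => EReal.coe_le_coe_iff.2 (hM ⟨_, ?_, rfl⟩)
      simpa using hbdd Δ hΔ hle k ω
  · filter_upwards [hlim Δ hΔ hle] with ω hω
    have hset : {x | w x = 0} = {0} := Set.ext fun x => hker x
    simp_rw [hset, Metric.infEDist_singleton] at hω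
    exact tendsto_iff_edist_tendsto_0.2 hω
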